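/- Let $n\ge 3$, let $\Omega\subset\mathbb{R}^n$ be a smooth bounded domain, let $2^*=\frac{2n}{n-2}$ and let $\lambda\ge 0$. Let $H^1_0(\Omega)$ be the closure of $C_c^\infty(\Omega)$ for the norm $\|\nabla v\|_2$, and let $\|\cdot\|_{2^*}$ be the norm of $L^{2^*}(\Omega)$. All equations below are understood in the weak sense, tested against all $v\in H^1_0(\Omega)$. For a weight $w\in L^{2^*}(\Omega)\setminus\{0\}$ with $w\ge 0$ a.e., let $K_w$ be the space of measurable functions $v:\Omega\to\mathbb{R}$ with $w^{\frac{2}{n-2}}v=0$ a.e., and let $L^2_w(\Omega)=L^2(\Omega,w^{2^*-2}dx)/K_w$. For a linear subspace $V\subset H^1_0(\Omega)$ and $k\ge 1$, write $\dim_w V=k$ if $V=\mathrm{Span}(v_1,\dots,v_k)$ for some $v_1,\dots,v_k\in H^1_0(\Omega)$ that are linearly independent in $L^2_w(\Omega)$. For $k\ge1$ define the generalised eigenvalue $$\mu_k^\lambda(w)=\inf_{\dim_w V=k}\ \max_{v\in V\setminus\{0\}}\frac{\int_\Omega\left(|\nabla v|^2-\lambda v^2\right)dx}{\int_\Omega w^{2^*-2}v^2\,dx}\in[-\infty,+\infty),$$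 the infimum being over linear subspaces $V\subset H^1_0(\Omega)$, and, when $\mu_k^\lambda(w)$ is finite, let the generalised eigenspace $E_k^\lambda(w)$ be the set of all $\varphi\in H^1_0(\Omega)$ with $-\Delta\varphi-\lambda\varphi=\mu_k^\lambda(w)\,w^{2^*-2}\varphi$ in $\Omega$. Let $u\in H^1_0(\Omega)\setminus\{0\}$ and $\tilde u=u/\|u\|_{2^*}$. Then $u$ is a solution of the Brézis–Nirenberg problem $$-\Delta u-\lambda u=|u|^{2^*-2}u\ \text{ in }\Omega,\qquad u=0\ \text{ on }\partial\Omega,$$ if and only if there exists $k\ge1$ such that $\mu_k^\lambda(|\tilde u|)=\|u\|_{2^*}^{2^*-2}$ and $\tilde u\in E_k^\lambda(|\tilde u|)$. -/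

import Mathlib

open MeasureTheory TopologicalSpace
open scoped ContDiff Distributions Gradient ENNReal

noncomputable section

namespace BrezisNirenberg

/-- A smooth bounded domain of `ℝⁿ`: a nonempty connected bounded open set whose boundary is locally
the zero set of a smooth function with non-vanishing derivative, the set lying locally on one side
of its boundary. -/
structure IsSmoothBoundedDomain {n : ℕ} (Ω : Opens (EuclideanSpace ℝ (Fin n))) : Prop where
  isConnected : IsConnected (Ω : Set (EuclideanSpace ℝ (Fin n)))
  isBounded : Bornology.IsBounded (Ω : Set (EuclideanSpace ℝ (Fin n)))
  smooth_boundary : ∀ x ∈ frontier (Ω : Set (EuclideanSpace ℝ (Fin n))),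
    ∃ U : Set (EuclideanSpace ℝ (Fin n)), IsOpen U ∧ x ∈ U ∧
      ∃ ρ : EuclideanSpace ℝ (Fin n) → ℝ, ContDiffOn ℝ ∞ ρ U ∧ fderiv ℝ ρ x ≠ 0 ∧
        ∀ y ∈ U, (y ∈ Ω ↔ ρ y < 0)

variable {n : ℕ}

/-- The critical Sobolev exponent `2* = 2n/(n-2)`. -/
def critExp (n : ℕ) : ℝ := 2 * (n : ℝ) / ((n : ℝ) - 2)

/-- Lebesgue measure on `Ω`. -/
abbrev vol (Ω : Opens (EuclideanSpace ℝ (Fin n))) : Measure (EuclideanSpace ℝ (Fin n)) :=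
  volume.restrict (Ω : Set (EuclideanSpace ℝ (Fin n)))

/-- The Hilbert space `L²(Ω) × L²(Ω; ℝⁿ)`. -/
abbrev L2Pair (Ω : Opens (EuclideanSpace ℝ (Fin n))) : Type :=
  WithLp 2 (Lp ℝ 2 (vol Ω) × Lp (EuclideanSpace ℝ (Fin n)) 2 (vol Ω))

/-- The pairs `(φ, ∇φ)` with `φ ∈ C_c^∞(Ω)`, as a subspace of `L²(Ω) × L²(Ω; ℝⁿ)`. -/
def testPairs (Ω : Opens (EuclideanSpace ℝ (Fin n))) : Submodule ℝ (L2Pair Ω) where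
  carrier := {p | ∃ φ : 𝓓(Ω, ℝ), p.fst =ᵐ[vol Ω] φ ∧ p.snd =ᵐ[vol Ω] ∇ (φ : _ → ℝ)}
  zero_mem' := by
    refine ⟨0, Lp.coeFn_zero _ _ _, ?_⟩
    filter_upwards [Lp.coeFn_zero (EuclideanSpace ℝ (Fin n)) 2 (vol Ω)] with x hx
    have h0 : ((0 : 𝓓(Ω, ℝ)) : EuclideanSpace ℝ (Fin n) → ℝ) = fun _ => 0 := rfl
    rw [h0]
    simpa [gradient] using hx
  add_mem' := by
    rintro p q ⟨φ, hp, hp'⟩ ⟨ψ, hq, hq'⟩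
    refine ⟨φ + ψ, ?_, ?_⟩
    · filter_upwards [Lp.coeFn_add p.fst q.fst, hp, hq] with x h h1 h2
      change (p.fst + q.fst : Lp ℝ 2 (vol Ω)) x = φ x + ψ x
      rw [h, Pi.add_apply, h1, h2]
    · filter_upwards [Lp.coeFn_add p.snd q.snd, hp', hq'] with x h h1 h2
      have dφ := (φ.contDiff.differentiable (by simp)) x
      have dψ := (ψ.contDiff.differentiable (by simp)) x
      change (p.snd + q.snd : Lp (EuclideanSpace ℝ (Fin n)) 2 (vol Ω)) x =
        ∇ ((φ : EuclideanSpace ℝ (Fin n) → ℝ) + (ψ : EuclideanSpace ℝ (Fin n) → ℝ)) x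
      rw [h, Pi.add_apply, h1, h2]
      simp [gradient, fderiv_add dφ dψ]
  smul_mem' := by
    rintro c p ⟨φ, hp, hp'⟩
    refine ⟨c • φ, ?_, ?_⟩
    · filter_upwards [Lp.coeFn_smul c p.fst, hp] with x h h1
      change (c • p.fst : Lp ℝ 2 (vol Ω)) x = c • φ x
      rw [h, Pi.smul_apply, h1]
    · filter_upwards [Lp.coeFn_smul c p.snd, hp'] with x h h1
      have dφ := (φ.contDiff.differentiable (by simp)) x
      change (c • p.snd : Lp (EuclideanSpace ℝ (Fin n)) 2 (vol Ω)) x =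
        ∇ (c • (φ : EuclideanSpace ℝ (Fin n) → ℝ)) x
      rw [h, Pi.smul_apply, h1]
      simp [gradient, fderiv_const_smul dφ c]

/-- `H¹₀(Ω)`: the closure of `C_c^∞(Ω)` in the `H¹` norm `(‖v‖₂² + ‖∇v‖₂²)^{1/2}`, which on bounded
`Ω` is equivalent to `‖∇v‖₂`. A function `v` is recorded together with its weak gradient. -/
abbrev H10 (Ω : Opens (EuclideanSpace ℝ (Fin n))) : Submodule ℝ (L2Pair Ω) :=
  (testPairs Ω).topologicalClosure

variable {Ω : Opens (EuclideanSpace ℝ (Fin n))}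

/-- The function underlying an element of `H¹₀(Ω)`. -/
def fn (v : H10 Ω) : Lp ℝ 2 (vol Ω) := (v : L2Pair Ω).fst

/-- The weak gradient of an element of `H¹₀(Ω)`. -/
def grad (v : H10 Ω) : Lp (EuclideanSpace ℝ (Fin n)) 2 (vol Ω) := (v : L2Pair Ω).snd

/-- The norm `‖u‖_{2*}` of `L^{2*}(Ω)`. -/
def critNorm (u : H10 Ω) : ℝ := lpNorm (fn u) (ENNReal.ofReal (critExp n)) (vol Ω)

/-- `φ ∈ H¹₀(Ω)` is a weak solution of `-Δφ - lam φ = f` in `Ω`. -/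
def IsWeakSol (lam : ℝ) (φ : H10 Ω) (f : EuclideanSpace ℝ (Fin n) → ℝ) : Prop :=
  ∀ v : H10 Ω, (∫ x, inner ℝ (grad φ x) (grad v x) ∂(vol Ω)) -
      lam * (∫ x, fn φ x * fn v x ∂(vol Ω)) =
    ∫ x, f x * fn v x ∂(vol Ω)

/-- `u` solves the Brézis–Nirenberg problem `-Δu - lam u = |u|^{2*-2} u` in `Ω`, `u = 0` on `∂Ω`. -/
def SolvesBN (lam : ℝ) (u : H10 Ω) : Prop :=
  IsWeakSol lam u (fun x => |fn u x| ^ (critExp n - 2) * fn u x)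

/-- The space `K_w` of measurable functions `v` (up to equality a.e.) with `w^{2/(n-2)} v = 0` a.e.
in `Ω`. -/
def weightNull (Ω : Opens (EuclideanSpace ℝ (Fin n))) (w : EuclideanSpace ℝ (Fin n) → ℝ) :
    Submodule ℝ (EuclideanSpace ℝ (Fin n) →ₘ[vol Ω] ℝ) where
  carrier := {v | ∀ᵐ x ∂(vol Ω), w x ^ (2 / ((n : ℝ) - 2)) * v x = 0}
  zero_mem' := by
    filter_upwards [AEEqFun.coeFn_zero (α := EuclideanSpace ℝ (Fin n)) (μ := vol Ω) (β := ℝ)]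
      with x hx
    simp [hx]
  add_mem' := by
    intro v v' hv hv'
    change ∀ᵐ x ∂(vol Ω), w x ^ (2 / ((n : ℝ) - 2)) * (v + v') x = 0
    filter_upwards [AEEqFun.coeFn_add v v', hv, hv'] with x h h1 h2
    rw [h, Pi.add_apply, mul_add, h1, h2, add_zero]
  smul_mem' := by
    intro c v hv
    change ∀ᵐ x ∂(vol Ω), w x ^ (2 / ((n : ℝ) - 2)) * (c • v) x = 0
    filter_upwards [AEEqFun.coeFn_smul c v, hv] with x h h1
    rw [h, Pi.smul_apply, smul_eq_mul, mul_left_comm, h1, mul_zero]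

/-- `dim_w V = k`: `V` is spanned by `k` elements of `H¹₀(Ω)` whose classes modulo `K_w`
(that is, in the weighted space `L²(Ω, w^{2*-2} dx) / K_w`) are linearly independent. -/
def HasWeightedDim (w : EuclideanSpace ℝ (Fin n) → ℝ) (V : Submodule ℝ (H10 Ω)) (k : ℕ) : Prop :=
  ∃ v : Fin k → H10 Ω, V = Submodule.span ℝ (Set.range v) ∧
    LinearIndependent ℝ
      (fun i => (weightNull Ω w).mkQ (fn (v i) : EuclideanSpace ℝ (Fin n) →ₘ[vol Ω] ℝ))

/-- The generalised Rayleigh quotient `∫ (|∇v|² - lam v²) / ∫ w^{2*-2} v²`. -/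
def rayleigh (lam : ℝ) (w : EuclideanSpace ℝ (Fin n) → ℝ) (v : H10 Ω) : ℝ :=
  (∫ x, (‖grad v x‖ ^ 2 - lam * fn v x ^ 2) ∂(vol Ω)) /
    ∫ x, w x ^ (critExp n - 2) * fn v x ^ 2 ∂(vol Ω)

/-- The generalised eigenvalue `μ_k^lam(w) ∈ [-∞, ∞]`, the infimum over all subspaces `V` of
`H¹₀(Ω)` with `dim_w V = k` of the maximum over `V \ {0}` of the Rayleigh quotient. -/
def genEigenvalue (Ω : Opens (EuclideanSpace ℝ (Fin n))) (lam : ℝ)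
    (w : EuclideanSpace ℝ (Fin n) → ℝ) (k : ℕ) : EReal :=
  ⨅ (V : Submodule ℝ (H10 Ω)) (_ : HasWeightedDim w V k), ⨆ v ∈ {v : H10 Ω | v ∈ V ∧ v ≠ 0},
    (rayleigh lam w v : EReal)

/-- The generalised eigenspace `E_k^lam(w)`: the `φ ∈ H¹₀(Ω)` that solve weakly
`-Δφ - lam φ = μ_k^lam(w) w^{2*-2} φ` in `Ω`; it is meaningful (and nonempty) only if
`μ_k^lam(w)` is finite. -/
def genEigenspace (Ω : Opens (EuclideanSpace ℝ (Fin n))) (lam : ℝ)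
    (w : EuclideanSpace ℝ (Fin n) → ℝ) (k : ℕ) : Set (H10 Ω) :=
  {φ | ∃ μ : ℝ, genEigenvalue Ω lam w k = (μ : EReal) ∧
    IsWeakSol lam φ (fun x => μ * w x ^ (critExp n - 2) * fn φ x)}

end BrezisNirenberg

end

/-!
Put `ũ = u / ‖u‖_{2*}`, `μ = ‖u‖_{2*}^{2*-2}`, and let `T : H¹₀(Ω) → L²(Ω)` be multiplication by
`|ũ|^{2/(n-2)}`, so that `‖T v‖² = ∫ |ũ|^{2*-2} v²`. By homogeneity `u` solves the nonlinear problem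
if and only if `ũ` lies in the kernel of the form `B_μ(v) = ∫ |∇v|² - lam ∫ v² - μ ‖T v‖²`. What has
to be shown is that `μ` is then one of the min-max values.

Both `v ↦ v` and `T` are bounded by `ε ‖∇v‖` on a subspace of finite codimension. For functions
with zero mean on every cube of a fine grid this is Poincaré's inequality on cubes; for `T` one
approximates the weight, which lies in `Lⁿ`, by a compactly supported continuous function and
controls the error with Sobolev's inequality. Hence `B_μ` has finite Morse index `m`, and
`μ_{m+1} = μ`: as no family of `m + 1` vectors is negative for `B_μ`, `μ_{m+1} ≥ μ`; and for
`s > μ`, adjoining `ũ` to a maximal negative family for `B_μ` yields `m + 1` vectors that are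
negative for `B_s`. Their images under `T` may be dependent, but negativity is an open condition and
`T` has infinite rank, so a small perturbation makes them independent and `μ_{m+1} ≤ s`.
-/

noncomputable section

namespace BrezisNirenberg

section MinMax

theorem exists_forall_linearIndependent_add_smul {K V W : Type*} [Field K] [AddCommGroup V]
    [Module K V] [AddCommGroup W] [Module K W] {T : V →ₗ[K] W} (hT : ¬ (LinearMap.range T).FG)
    {k : ℕ} (v : Fin k → V) :
    ∃ e : Fin k → V, ∀ t : K, t ≠ 0 → LinearIndependent K fun i => T (v i + t • e i) := by
  let S : Submodule K W := Submodule.span K (Set.range fun i => T (v i))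
  have hS : S.FG := Submodule.fg_span (Set.finite_range _)
  have hrange : ¬ (LinearMap.range (S.mkQ ∘ₗ T)).FG := by
    intro hfg
    refine hT (Submodule.fg_of_fg_map_of_fg_inf_ker S.mkQ ?_ ?_)
    · rwa [← LinearMap.range_comp]
    · have : FiniteDimensional K S := Module.Finite.iff_fg.2 hS
      rw [Submodule.ker_mkQ]
      exact Module.Finite.iff_fg.1 (Submodule.finiteDimensional_of_le inf_le_right)
  have hrank : (k : Cardinal) ≤ Module.rank K (LinearMap.range (S.mkQ ∘ₗ T)) := by
    by_contra! hlt
    exact hrange (Module.Finite.iff_fg.1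
      (Module.rank_lt_aleph0_iff.1 (hlt.trans Cardinal.natCast_lt_aleph0)))
  obtain ⟨f, hf⟩ := exists_linearIndependent_of_le_rank hrank
  choose e he using fun i => (f i).2
  have he_indep : LinearIndependent K fun i => (S.mkQ ∘ₗ T) (e i) := by
    simp only [he]
    exact hf.map' _ (Submodule.ker_subtype _)
  refine ⟨e, fun t ht => LinearIndependent.of_comp S.mkQ ?_⟩
  convert he_indep.units_smul fun _ => Units.mk0 t ht using 1
  funext i
  have hv : S.mkQ (T (v i)) = 0 :=
    (Submodule.Quotient.mk_eq_zero S).2 (Submodule.subset_span ⟨i, rfl⟩)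
  simp only [Function.comp_apply, Pi.smul_apply', Units.smul_mk0, map_add, map_smul, hv,
    zero_add, LinearMap.comp_apply]

variable {H ι : Type*} [NormedAddCommGroup H] [NormedSpace ℝ H] [Fintype ι]

/-- `B` is negative definite on the family `v`: the family is linearly independent and the
quadratic form `B x x` is negative definite on its span. -/
def IsNegDefOn (B : H →L[ℝ] H →L[ℝ] ℝ) (v : ι → H) : Prop :=
  ∀ a : ι → ℝ, a ≠ 0 → B (∑ i, a i • v i) (∑ i, a i • v i) < 0

theorem IsNegDefOn.eventually_add_smul {B : H →L[ℝ] H →L[ℝ] ℝ} {v : ι → H}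
    (hv : IsNegDefOn B v) (e : ι → H) :
    ∀ᶠ t : ℝ in nhds 0, IsNegDefOn B fun i => v i + t • e i := by
  have hcont : Continuous fun z : ℝ × (ι → ℝ) =>
      B (∑ i, z.2 i • (v i + z.1 • e i)) (∑ i, z.2 i • (v i + z.1 • e i)) := by fun_prop
  have hsphere : ∀ᶠ t : ℝ in nhds 0, ∀ a ∈ Metric.sphere (0 : ι → ℝ) 1,
      B (∑ i, a i • (v i + t • e i)) (∑ i, a i • (v i + t • e i)) < 0 := by
    refine (isCompact_sphere (0 : ι → ℝ) 1).eventually_forall_of_forall_eventually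
      fun a ha => hcont.continuousAt.eventually_lt continuousAt_const ?_
    simpa only [zero_smul, add_zero] using hv a (ne_zero_of_mem_unit_sphere ⟨a, ha⟩)
  filter_upwards [hsphere] with t ht a ha
  have hnorm : ‖a‖ ≠ 0 := norm_ne_zero_iff.2 ha
  have hscale : ∑ i, a i • (v i + t • e i) = ‖a‖ • ∑ i, (‖a‖⁻¹ • a) i • (v i + t • e i) := by
    simp only [Finset.smul_sum, Pi.smul_apply, smul_smul, smul_eq_mul,
      mul_inv_cancel_left₀ hnorm]
  rw [hscale, map_smul, map_smul, smul_apply, smul_smul, smul_eq_mul]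
  exact mul_neg_of_pos_of_neg (by positivity) (ht (‖a‖⁻¹ • a) (by simp [norm_smul, hnorm]))

theorem IsNegDefOn.exists_linearIndependent {W : Type*} [AddCommGroup W] [Module ℝ W]
    {B : H →L[ℝ] H →L[ℝ] ℝ} {k : ℕ} {v : Fin k → H} (hv : IsNegDefOn B v) {T : H →ₗ[ℝ] W}
    (hT : ¬ (LinearMap.range T).FG) :
    ∃ v' : Fin k → H, LinearIndependent ℝ (T ∘ v') ∧ IsNegDefOn B v' := by
  obtain ⟨e, he⟩ := exists_forall_linearIndependent_add_smul hT v
  obtain ⟨t, hneg, ht⟩ := (((hv.eventually_add_smul e).filter_mono nhdsWithin_le_nhds).and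
    (self_mem_nhdsWithin : {(0 : ℝ)}ᶜ ∈ nhdsWithin 0 {0}ᶜ)).exists
  exact ⟨_, he t ht, hneg⟩

theorem IsNegDefOn.card_le_finrank_quotient {B : H →L[ℝ] H →L[ℝ] ℝ} {v : ι → H}
    (hv : IsNegDefOn B v) {L : Submodule ℝ H} (hL : L.CoFG) (hB : ∀ x ∈ L, 0 ≤ B x x) :
    Fintype.card ι ≤ Module.finrank ℝ (H ⧸ L) := by
  have hindep : LinearIndependent ℝ (L.mkQ ∘ v) := by
    refine Fintype.linearIndependent_iff.2 fun a ha => congrFun ?_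
    by_contra hne
    have hmem : ∑ i, a i • v i ∈ L := by
      rw [← Submodule.Quotient.mk_eq_zero, ← Submodule.mkQ_apply, map_sum]
      simpa only [map_smul, Function.comp_apply] using ha
    exact (hv a hne).not_ge (hB _ hmem)
  exact hindep.fintype_card_le_finrank

variable {W : Type*} [NormedAddCommGroup W] [NormedSpace ℝ W]

/-- The `k`-th min-max value of `A x x / ‖T x‖ ^ 2`, over subspaces spanned by `k` vectors whose
images under `T` are linearly independent. -/
def minmaxValue (A : H →L[ℝ] H →L[ℝ] ℝ) (T : H →L[ℝ] W) (k : ℕ) : EReal :=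
  ⨅ (V : Submodule ℝ H)
    (_ : ∃ v : Fin k → H, V = Submodule.span ℝ (Set.range v) ∧ LinearIndependent ℝ (T ∘ v)),
    ⨆ x ∈ {x : H | x ∈ V ∧ x ≠ 0}, ((A x x / ‖T x‖ ^ 2 : ℝ) : EReal)

theorem norm_map_sum_smul_pos {T : H →L[ℝ] W} {v : ι → H} (hv : LinearIndependent ℝ (T ∘ v))
    {a : ι → ℝ} (ha : a ≠ 0) : 0 < ‖T (∑ i, a i • v i)‖ := by
  refine norm_pos_iff.2 fun h => ha (funext (Fintype.linearIndependent_iff.1 hv a ?_))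
  simpa only [map_sum, map_smul, Function.comp_apply] using h

variable {Z : Type*} [NormedAddCommGroup Z] [InnerProductSpace ℝ Z]

/-- The bounded bilinear form `⟪T x, T y⟫`. -/
def pullbackInner (T : H →L[ℝ] Z) : H →L[ℝ] H →L[ℝ] ℝ :=
  (isBoundedBilinearMap_inner (𝕜 := ℝ)).toContinuousLinearMap.bilinearComp T T

/-- The form `A x y - μ ⟪T x, T y⟫`, whose kernel is the eigenspace of `A` relative to `T`
at `μ`. -/
def shiftedForm (A : H →L[ℝ] H →L[ℝ] ℝ) (T : H →L[ℝ] Z) (μ : ℝ) : H →L[ℝ] H →L[ℝ] ℝ :=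
  A - μ • pullbackInner T

variable {A : H →L[ℝ] H →L[ℝ] ℝ} {T : H →L[ℝ] Z} {μ s : ℝ} {k : ℕ}

theorem shiftedForm_apply (x y : H) :
    shiftedForm A T μ x y = A x y - μ * inner ℝ (T x) (T y) := rfl

theorem shiftedForm_apply_self (x : H) : shiftedForm A T μ x x = A x x - μ * ‖T x‖ ^ 2 := by
  rw [shiftedForm_apply, real_inner_self_eq_norm_sq]

theorem IsNegDefOn.snoc_eigenvector (hA : ∀ x y, A x y = A y x) {v : Fin k → H}
    (hv : IsNegDefOn (shiftedForm A T μ) v) {u : H} (hTu : T u ≠ 0)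
    (hu : ∀ y, A u y = μ * inner ℝ (T u) (T y)) (hs : μ < s) :
    IsNegDefOn (shiftedForm A T s) (Fin.snoc v u : Fin (k + 1) → H) := by
  intro a ha
  rw [Fin.sum_univ_castSucc]
  simp only [Fin.snoc_castSucc, Fin.snoc_last]
  set b : Fin k → ℝ := fun i => a i.castSucc
  set c : ℝ := a (Fin.last k)
  set x : H := ∑ i, b i • v i
  have hexpand : shiftedForm A T s (x + c • u) (x + c • u) =
      shiftedForm A T μ x x - (s - μ) * ‖T (x + c • u)‖ ^ 2 := by
    simp only [shiftedForm_apply, ← real_inner_self_eq_norm_sq, map_add, map_smul,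
      add_apply, smul_apply, inner_add_left, inner_add_right, real_inner_smul_left,
      real_inner_smul_right, smul_eq_mul, hA x u, hu, real_inner_comm (T u) (T x)]
    ring
  rw [hexpand]
  by_cases hb : b = 0
  · have hx : x = 0 := by simp [x, hb]
    have hc : c ≠ 0 := fun hc => ha (funext (Fin.lastCases hc (congrFun hb)))
    have hT : 0 < ‖T (x + c • u)‖ := by simpa [hx, hc] using hTu
    rw [hx] at hT ⊢
    have := mul_pos (sub_pos.2 hs) (pow_pos hT 2)
    rw [map_zero]
    linarith
  · have := mul_nonneg (sub_pos.2 hs).le (sq_nonneg ‖T (x + c • u)‖)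
    linarith [hv b hb]

theorem minmaxValue_le {v : Fin k → H} (hTv : LinearIndependent ℝ (T ∘ v))
    (hv : IsNegDefOn (shiftedForm A T s) v) : minmaxValue A T k ≤ s := by
  refine iInf₂_le_of_le _ ⟨v, rfl, hTv⟩ (iSup₂_le ?_)
  rintro x ⟨hxV, hx⟩
  obtain ⟨a, rfl⟩ := (Submodule.mem_span_range_iff_exists_fun ℝ).1 hxV
  have ha : a ≠ 0 := by
    rintro rfl
    simp at hx
  have hpos := norm_map_sum_smul_pos hTv ha
  have hneg := hv a ha
  rw [shiftedForm_apply_self] at hneg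
  rw [EReal.coe_le_coe_iff, div_le_iff₀ (by positivity)]
  linarith

theorem le_minmaxValue (h : ∀ v : Fin k → H, ¬ IsNegDefOn (shiftedForm A T μ) v) :
    (μ : EReal) ≤ minmaxValue A T k := by
  refine le_iInf₂ ?_
  rintro _ ⟨v, rfl, hTv⟩
  obtain ⟨a, ha, hnonneg⟩ : ∃ a : Fin k → ℝ, a ≠ 0 ∧
      0 ≤ shiftedForm A T μ (∑ i, a i • v i) (∑ i, a i • v i) := by
    simpa [IsNegDefOn] using h v
  have hpos := norm_map_sum_smul_pos hTv ha
  have hmem : ∑ i, a i • v i ∈ Submodule.span ℝ (Set.range v) :=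
    (Submodule.mem_span_range_iff_exists_fun ℝ).2 ⟨a, rfl⟩
  have hne : ∑ i, a i • v i ≠ 0 := fun h0 => by simp [h0] at hpos
  refine le_iSup₂_of_le _ ⟨hmem, hne⟩ ?_
  rw [shiftedForm_apply_self] at hnonneg
  rw [EReal.coe_le_coe_iff, le_div_iff₀ (by positivity)]
  linarith

theorem exists_minmaxValue_eq (hA : ∀ x y, A x y = A y x)
    (hT : ¬ (LinearMap.range T.toLinearMap).FG) {L : Submodule ℝ H} (hL : L.CoFG)
    (hnonneg : ∀ x ∈ L, 0 ≤ shiftedForm A T μ x x) {u : H} (hTu : T u ≠ 0)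
    (hu : ∀ y, A u y = μ * inner ℝ (T u) (T y)) :
    ∃ k : ℕ, 1 ≤ k ∧ minmaxValue A T k = μ := by
  let HasNegDef (k : ℕ) : Prop := ∃ v : Fin k → H, IsNegDefOn (shiftedForm A T μ) v
  have hzero : HasNegDef 0 := ⟨Fin.elim0, fun a ha => absurd (Subsingleton.elim a 0) ha⟩
  obtain ⟨m, ⟨v, hv⟩, hm⟩ : ∃ m, HasNegDef m ∧ ¬ HasNegDef (m + 1) := by
    by_contra! hsucc
    obtain ⟨v, hv⟩ : HasNegDef (Module.finrank ℝ (H ⧸ L) + 1) :=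
      Nat.rec (motive := HasNegDef) hzero hsucc _
    simpa using hv.card_le_finrank_quotient hL hnonneg
  refine ⟨m + 1, m.succ_pos, le_antisymm ?_ (le_minmaxValue (not_exists.1 hm))⟩
  refine EReal.le_of_forall_lt_iff_le.1 fun s hs => ?_
  obtain ⟨v', hTv', hv'⟩ :=
    (hv.snoc_eigenvector hA hTu hu (EReal.coe_lt_coe_iff.1 hs)).exists_linearIndependent hT
  exact minmaxValue_le hTv' hv'

end MinMax

section Translation

variable {E F : Type*} [NormedAddCommGroup E] [NormedSpace ℝ E] [NormedAddCommGroup F]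
  [NormedSpace ℝ F] {f : E → F}

theorem enorm_sub_rpow_le_lintegral_fderiv (hf : ContDiff ℝ 1 f) {p : ℝ} (hp : 1 ≤ p) (x h : E) :
    ‖f (x + h) - f x‖ₑ ^ p ≤
      ‖h‖ₑ ^ p * ∫⁻ t in Set.Icc (0 : ℝ) 1, ‖fderiv ℝ f (x + t • h)‖ₑ ^ p := by
  have hp0 : 0 < p := one_pos.trans_le hp
  have hcont : Continuous fun t : ℝ => fderiv ℝ f (x + t • h) :=
    (hf.continuous_fderiv one_ne_zero).comp (by fun_prop)
  have hderiv (t : ℝ) : deriv (fun t : ℝ => f (x + t • h)) t = fderiv ℝ f (x + t • h) h := by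
    have hline : HasDerivAt (fun t : ℝ => x + t • h) h t := by
      simpa only [one_smul, id] using ((hasDerivAt_id t).smul_const h).const_add x
    exact ((hf.differentiable one_ne_zero _).hasFDerivAt.comp_hasDerivAt t hline).deriv
  have hbound : ‖f (x + h) - f x‖ₑ ≤
      ‖h‖ₑ * ∫⁻ t in Set.Icc (0 : ℝ) 1, ‖fderiv ℝ f (x + t • h)‖ₑ := by
    have hftc := enorm_sub_le_lintegral_deriv_of_contDiffOn_Icc
      (hf.comp (by fun_prop : ContDiff ℝ 1 fun t : ℝ => x + t • h)).contDiffOn zero_le_one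
    simp only [Function.comp_apply, one_smul, zero_smul, add_zero] at hftc
    refine hftc.trans ?_
    rw [← lintegral_const_mul' _ _ enorm_ne_top]
    refine lintegral_mono fun t => ?_
    rw [Function.comp_def, hderiv, mul_comm]
    exact ContinuousLinearMap.le_opENorm _ _
  have : IsProbabilityMeasure (volume.restrict (Set.Icc (0 : ℝ) 1)) := ⟨by simp⟩
  have hjensen := eLpNorm'_le_eLpNorm'_of_exponent_le one_pos hp _
    (hcont.aestronglyMeasurable (μ := volume.restrict (Set.Icc (0 : ℝ) 1)))
  rw [eLpNorm'_eq_lintegral_enorm, eLpNorm'_eq_lintegral_enorm, one_div_one, ENNReal.rpow_one,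
    one_div, ENNReal.le_rpow_inv_iff hp0] at hjensen
  simp only [ENNReal.rpow_one] at hjensen
  calc ‖f (x + h) - f x‖ₑ ^ p
      ≤ (‖h‖ₑ * ∫⁻ t in Set.Icc (0 : ℝ) 1, ‖fderiv ℝ f (x + t • h)‖ₑ) ^ p := by gcongr
    _ = ‖h‖ₑ ^ p * (∫⁻ t in Set.Icc (0 : ℝ) 1, ‖fderiv ℝ f (x + t • h)‖ₑ) ^ p :=
        ENNReal.mul_rpow_of_nonneg _ _ hp0.le
    _ ≤ _ := by gcongr

variable [FiniteDimensional ℝ E] [MeasurableSpace E] [BorelSpace E] (μ : Measure E)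
  [μ.IsAddHaarMeasure]

theorem lintegral_enorm_sub_translate_rpow_le (hf : ContDiff ℝ 1 f) {p : ℝ} (hp : 1 ≤ p) (h : E) :
    ∫⁻ x, ‖f (x + h) - f x‖ₑ ^ p ∂μ ≤ ‖h‖ₑ ^ p * ∫⁻ x, ‖fderiv ℝ f x‖ₑ ^ p ∂μ := by
  have hcont : Continuous (fderiv ℝ f) := hf.continuous_fderiv one_ne_zero
  have hhp : ‖h‖ₑ ^ p ≠ ⊤ := ENNReal.rpow_ne_top_of_nonneg (zero_le_one.trans hp) enorm_ne_top
  calc ∫⁻ x, ‖f (x + h) - f x‖ₑ ^ p ∂μ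
      ≤ ∫⁻ x, ‖h‖ₑ ^ p * (∫⁻ t in Set.Icc (0 : ℝ) 1, ‖fderiv ℝ f (x + t • h)‖ₑ ^ p) ∂μ :=
        lintegral_mono fun x => enorm_sub_rpow_le_lintegral_fderiv hf hp x h
    _ = ‖h‖ₑ ^ p * ∫⁻ t in Set.Icc (0 : ℝ) 1, ∫⁻ x, ‖fderiv ℝ f (x + t • h)‖ₑ ^ p ∂μ := by
        rw [lintegral_const_mul' _ _ hhp, lintegral_lintegral_swap]
        exact ((hcont.comp (by fun_prop)).enorm.measurable.pow_const p).aemeasurable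
    _ = ‖h‖ₑ ^ p * ∫⁻ x, ‖fderiv ℝ f x‖ₑ ^ p ∂μ := by
        simp only [lintegral_add_right_eq_self fun x => ‖fderiv ℝ f x‖ₑ ^ p, lintegral_const,
          Measure.restrict_apply_univ, Real.volume_Icc, sub_zero, ENNReal.ofReal_one, mul_one]

theorem setLIntegral_nearDiagonal_enorm_sub_rpow_le (hf : ContDiff ℝ 1 f) {p : ℝ} (hp : 1 ≤ p)
    (d : NNReal) :
    ∫⁻ z in {z : E × E | ‖z.2 - z.1‖ ≤ d}, ‖f z.2 - f z.1‖ₑ ^ p ∂μ.prod μ ≤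
      μ (Metric.closedBall 0 d) * (d ^ p * ∫⁻ x, ‖fderiv ℝ f x‖ₑ ^ p ∂μ) := by
  have hfm : Continuous f := hf.continuous
  have hmeas : Measurable fun z : E × E => ‖f z.2 - f z.1‖ₑ ^ p :=
    (Continuous.measurable (by fun_prop)).pow_const p
  have hpre : (fun z : E × E => (z.1, z.1 + z.2)) ⁻¹' {z | ‖z.2 - z.1‖ ≤ d} =
      Set.univ ×ˢ Metric.closedBall 0 (d : ℝ) := by
    ext z
    simp
  have hset : MeasurableSet {z : E × E | ‖z.2 - z.1‖ ≤ d} :=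
    (isClosed_le (by fun_prop) continuous_const).measurableSet
  calc ∫⁻ z in {z : E × E | ‖z.2 - z.1‖ ≤ d}, ‖f z.2 - f z.1‖ₑ ^ p ∂μ.prod μ
      = ∫⁻ h in Metric.closedBall 0 (d : ℝ), ∫⁻ x, ‖f (x + h) - f x‖ₑ ^ p ∂μ ∂μ := by
        rw [← (measurePreserving_prod_add μ μ).setLIntegral_comp_preimage hset hmeas, hpre,
          ← Measure.prod_restrict, Measure.restrict_univ, lintegral_prod_symm]
        exact (hmeas.comp (by fun_prop)).aemeasurable
    _ ≤ ∫⁻ _ in Metric.closedBall 0 (d : ℝ), d ^ p * ∫⁻ x, ‖fderiv ℝ f x‖ₑ ^ p ∂μ ∂μ := by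
        refine setLIntegral_mono' Metric.isClosed_closedBall.measurableSet fun h hh => ?_
        have hhd : ‖h‖ₑ ≤ d := by simpa [enorm_le_coe, ← NNReal.coe_le_coe] using hh
        refine (lintegral_enorm_sub_translate_rpow_le μ hf hp h).trans ?_
        gcongr
    _ = _ := by rw [setLIntegral_const, mul_comm]

theorem sum_setLIntegral_prod_self_enorm_sub_rpow_le (hf : ContDiff ℝ 1 f) {p : ℝ} (hp : 1 ≤ p)
    {ι : Type*} (J : Finset ι) {Q : ι → Set E} (hQ : ∀ i ∈ J, MeasurableSet (Q i))
    (hdisj : (J : Set ι).PairwiseDisjoint Q) {d : NNReal}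
    (hdiam : ∀ i ∈ J, ∀ x ∈ Q i, ∀ y ∈ Q i, ‖y - x‖ ≤ d) :
    ∑ i ∈ J, ∫⁻ z in Q i ×ˢ Q i, ‖f z.2 - f z.1‖ₑ ^ p ∂μ.prod μ ≤
      μ (Metric.closedBall 0 d) * (d ^ p * ∫⁻ x, ‖fderiv ℝ f x‖ₑ ^ p ∂μ) := by
  rw [← lintegral_biUnion_finset
    (fun i hi j hj hij => Set.Disjoint.set_prod_left (hdisj hi hj hij) _ _)
    fun i hi => (hQ i hi).prod (hQ i hi)]
  refine (lintegral_mono_set ?_).trans (setLIntegral_nearDiagonal_enorm_sub_rpow_le μ hf hp d)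
  rintro z hz
  obtain ⟨i, hi, hz⟩ := Set.mem_iUnion₂.1 hz
  exact hdiam i hi _ hz.1 _ hz.2

end Translation

theorem integral_prod_self_sub_sq {α : Type*} [MeasurableSpace α] {ν : Measure α}
    [IsFiniteMeasure ν] {f : α → ℝ} (hf : MemLp f 2 ν) :
    ∫ z, (f z.2 - f z.1) ^ 2 ∂ν.prod ν =
      2 * (ν.real Set.univ * ∫ x, f x ^ 2 ∂ν - (∫ x, f x ∂ν) ^ 2) := by
  have hf1 : Integrable f ν := hf.integrable (by norm_num)
  have hsq := hf.integrable_sq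
  have hexpand : (fun z : α × α => (f z.2 - f z.1) ^ 2) =
      fun z => f z.2 ^ 2 + f z.1 ^ 2 - 2 * (f z.1 * f z.2) := by
    funext z
    ring
  have hsq_add : Integrable (fun z : α × α => f z.2 ^ 2 + f z.1 ^ 2) (ν.prod ν) :=
    (hsq.comp_snd ν).add (hsq.comp_fst ν)
  rw [hexpand, integral_sub hsq_add ((hf1.mul_prod hf1).const_mul 2),
    integral_add (hsq.comp_snd ν) (hsq.comp_fst ν), integral_fun_snd (fun x => f x ^ 2),
    integral_fun_fst (fun x => f x ^ 2), integral_const_mul, integral_prod_mul]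
  simp only [smul_eq_mul]
  ring

theorem lowerSemicontinuous_eLpNorm {α E : Type*} [MeasurableSpace α] {μ : Measure α}
    [NormedAddCommGroup E] {q : ℝ≥0∞} [Fact (1 ≤ q)] (p : ℝ≥0∞) :
    LowerSemicontinuous fun f : Lp E q μ => eLpNorm f p μ := by
  refine lowerSemicontinuous_iff_isClosed_preimage.2 fun c => IsSeqClosed.isClosed ?_
  intro f g hf hlim
  obtain ⟨ns, -, hae⟩ := (tendstoInMeasure_of_tendsto_Lp hlim).exists_seq_tendsto_ae
  calc eLpNorm g p μ ≤ Filter.liminf (fun j => eLpNorm (f (ns j)) p μ) Filter.atTop :=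
        Lp.eLpNorm_lim_le_liminf_eLpNorm (fun j => Lp.aestronglyMeasurable _) _ hae
    _ ≤ Filter.liminf (fun _ => c) Filter.atTop :=
        Filter.liminf_le_liminf (.of_forall fun j => hf (ns j))
    _ = c := Filter.liminf_const c

theorem enorm_le_coe_mul_enorm_iff {E F : Type*} [SeminormedAddGroup E] [SeminormedAddGroup F]
    {a : E} {b : F} {C : NNReal} : ‖a‖ₑ ≤ C * ‖b‖ₑ ↔ ‖a‖ ≤ C * ‖b‖ := by
  rw [enorm_eq_nnnorm, enorm_eq_nnnorm, ← ENNReal.coe_mul, ENNReal.coe_le_coe, ← NNReal.coe_le_coe,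
    NNReal.coe_mul, coe_nnnorm, coe_nnnorm]

theorem eLpNorm_two_sq {α E : Type*} [MeasurableSpace α] [NormedAddCommGroup E] (f : α → E)
    (μ : Measure α) : eLpNorm f 2 μ ^ 2 = ∫⁻ x, ‖f x‖ₑ ^ 2 ∂μ := by
  simpa using eLpNorm_nnreal_pow_eq_lintegral (f := f) (μ := μ) (p := 2) two_ne_zero

theorem ofReal_integral_sq {α : Type*} [MeasurableSpace α] {μ : Measure α} {f : α → ℝ}
    (hf : MemLp f 2 μ) : ENNReal.ofReal (∫ x, f x ^ 2 ∂μ) = ∫⁻ x, ‖f x‖ₑ ^ 2 ∂μ := by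
  rw [ofReal_integral_eq_lintegral_ofReal hf.integrable_sq (.of_forall fun x => sq_nonneg _)]
  refine lintegral_congr fun x => ?_
  rw [← Real.enorm_of_nonneg (sq_nonneg _), enorm_pow]

theorem continuous_setIntegral_sq {α : Type*} [MeasurableSpace α] {μ : Measure α} (s : Set α) :
    Continuous fun f : Lp ℝ 2 μ => ∫ x in s, f x ^ 2 ∂μ := by
  have heq (f : Lp ℝ 2 μ) :
      ∫ x in s, f x ^ 2 ∂μ = ‖LpToLpRestrictCLM α ℝ ℝ μ 2 s f‖ ^ 2 := by
    rw [← real_inner_self_eq_norm_sq, L2.inner_def]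
    refine integral_congr_ae ?_
    filter_upwards [LpToLpRestrictCLM_coeFn ℝ s f] with x hx
    rw [hx, real_inner_self_eq_norm_sq, Real.norm_eq_abs, sq_abs]
  simp only [heq]
  fun_prop

/-- Integration over a set of finite measure, as a continuous functional on `L²`. -/
def setIntegralCLM {α : Type*} [MeasurableSpace α] {μ : Measure α} {s : Set α}
    (hs : MeasurableSet s) (hμs : μ s ≠ ⊤) : Lp ℝ 2 μ →L[ℝ] ℝ :=
  innerSL ℝ (indicatorConstLp 2 hs hμs 1)

theorem setIntegralCLM_apply {α : Type*} [MeasurableSpace α] {μ : Measure α} {s : Set α}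
    (hs : MeasurableSet s) (hμs : μ s ≠ ⊤) (f : Lp ℝ 2 μ) :
    setIntegralCLM hs hμs f = ∫ x in s, f x ∂μ :=
  L2.inner_indicatorConstLp_one hs hμs f

theorem ofReal_sum_variance_le {E ι : Type*} [NormedAddCommGroup E] [NormedSpace ℝ E]
    [FiniteDimensional ℝ E] [MeasurableSpace E] [BorelSpace E] (μ : Measure E)
    [μ.IsAddHaarMeasure] {f : E → ℝ} (hf : ContDiff ℝ 1 f) (hfc : HasCompactSupport f)
    (J : Finset ι) {Q : ι → Set E} (hQ : ∀ i ∈ J, MeasurableSet (Q i))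
    (hQμ : ∀ i ∈ J, μ (Q i) ≠ ⊤) (hdisj : (J : Set ι).PairwiseDisjoint Q) {d : NNReal}
    (hdiam : ∀ i ∈ J, ∀ x ∈ Q i, ∀ y ∈ Q i, ‖y - x‖ ≤ d) :
    ENNReal.ofReal (∑ i ∈ J,
        2 * (μ.real (Q i) * ∫ x in Q i, f x ^ 2 ∂μ - (∫ x in Q i, f x ∂μ) ^ 2)) ≤
      μ (Metric.closedBall 0 d) * (d * eLpNorm (fderiv ℝ f) 2 μ) ^ 2 := by
  have hcell (i) (hi : i ∈ J) :
      ENNReal.ofReal (2 * (μ.real (Q i) * ∫ x in Q i, f x ^ 2 ∂μ - (∫ x in Q i, f x ∂μ) ^ 2)) ≤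
        ∫⁻ z in Q i ×ˢ Q i, ‖f z.2 - f z.1‖ₑ ^ (2 : ℝ) ∂μ.prod μ := by
    have : IsFiniteMeasure (μ.restrict (Q i)) := ⟨by simpa using (hQμ i hi).lt_top⟩
    have hfi : MemLp f 2 (μ.restrict (Q i)) := hf.continuous.memLp_of_hasCompactSupport hfc
    have hdiff : MemLp (fun z : E × E => f z.2 - f z.1) 2
        ((μ.restrict (Q i)).prod (μ.restrict (Q i))) :=
      (hfi.comp_snd (μ.restrict (Q i))).sub (hfi.comp_fst (μ.restrict (Q i)))
    rw [← measureReal_restrict_apply_univ, ← integral_prod_self_sub_sq hfi,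
      ofReal_integral_sq hdiff, Measure.prod_restrict]
    simp only [ENNReal.rpow_two, le_refl]
  rw [mul_pow, eLpNorm_two_sq]
  calc _ ≤ ∑ i ∈ J, ∫⁻ z in Q i ×ˢ Q i, ‖f z.2 - f z.1‖ₑ ^ (2 : ℝ) ∂μ.prod μ :=
        (Finset.le_sum_of_subadditive _ ENNReal.ofReal_zero.le (fun _ _ => ENNReal.ofReal_add_le)
          _ _).trans
          (Finset.sum_le_sum hcell)
    _ ≤ _ := by
        simpa only [ENNReal.rpow_two] using
          sum_setLIntegral_prod_self_enorm_sub_rpow_le μ hf one_le_two J hQ hdisj hdiam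

section Sobolev

variable {n : ℕ} {Ω : Opens (EuclideanSpace ℝ (Fin n))}

/-- `fn` as a continuous linear map. -/
def fnCLM (Ω : Opens (EuclideanSpace ℝ (Fin n))) : H10 Ω →L[ℝ] Lp ℝ 2 (vol Ω) :=
  (WithLp.fstL 2 ℝ _ _).comp (H10 Ω).subtypeL

/-- `grad` as a continuous linear map. -/
def gradCLM (Ω : Opens (EuclideanSpace ℝ (Fin n))) :
    H10 Ω →L[ℝ] Lp (EuclideanSpace ℝ (Fin n)) 2 (vol Ω) :=
  (WithLp.sndL 2 ℝ _ _).comp (H10 Ω).subtypeL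

@[simp] theorem fnCLM_apply (v : H10 Ω) : fnCLM Ω v = fn v := rfl

@[fun_prop] theorem continuous_fn : Continuous (fn : H10 Ω → Lp ℝ 2 (vol Ω)) :=
  (fnCLM Ω).continuous

@[fun_prop] theorem continuous_grad :
    Continuous (grad : H10 Ω → Lp (EuclideanSpace ℝ (Fin n)) 2 (vol Ω)) :=
  (gradCLM Ω).continuous

theorem support_subset_of_test (φ : 𝓓(Ω, ℝ)) : Function.support φ ⊆ Ω :=
  (subset_tsupport _).trans φ.tsupport_subset

theorem continuous_gradient_of_test (φ : 𝓓(Ω, ℝ)) : Continuous (∇ (φ : _ → ℝ)) :=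
  (LinearIsometryEquiv.continuous _).comp (φ.contDiff.continuous_fderiv (by simp))

theorem memLp_of_test (φ : 𝓓(Ω, ℝ)) (p : ℝ≥0∞) : MemLp φ p (vol Ω) :=
  φ.continuous.memLp_of_hasCompactSupport φ.hasCompactSupport

theorem memLp_gradient_of_test (φ : 𝓓(Ω, ℝ)) (p : ℝ≥0∞) : MemLp (∇ (φ : _ → ℝ)) p (vol Ω) :=
  (continuous_gradient_of_test φ).memLp_of_hasCompactSupport
    ((φ.hasCompactSupport.fderiv ℝ).comp_left (map_zero _))

/-- The element of `H¹₀(Ω)` given by a test function. -/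
def ofTest (φ : 𝓓(Ω, ℝ)) : H10 Ω :=
  ⟨WithLp.toLp 2 ((memLp_of_test φ 2).toLp, (memLp_gradient_of_test φ 2).toLp),
    subset_closure ⟨φ, (memLp_of_test φ 2).coeFn_toLp,
      (memLp_gradient_of_test φ 2).coeFn_toLp⟩⟩

theorem fn_ofTest_ae (φ : 𝓓(Ω, ℝ)) : fn (ofTest φ) =ᵐ[vol Ω] φ :=
  (memLp_of_test φ 2).coeFn_toLp

theorem grad_ofTest_ae (φ : 𝓓(Ω, ℝ)) : grad (ofTest φ) =ᵐ[vol Ω] ∇ (φ : _ → ℝ) :=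
  (memLp_gradient_of_test φ 2).coeFn_toLp

theorem ext_fn_grad {v w : H10 Ω} (hfn : fn v = fn w) (hgrad : grad v = grad w) : v = w :=
  Subtype.ext (WithLp.ofLp_injective 2 (Prod.ext hfn hgrad))

theorem denseRange_ofTest : DenseRange (ofTest (Ω := Ω)) := by
  rintro ⟨v, hv⟩
  rw [closure_subtype]
  refine closure_mono ?_ hv
  rintro w ⟨φ, hfn, hgrad⟩
  refine ⟨⟨w, subset_closure ⟨φ, hfn, hgrad⟩⟩, ⟨φ, ext_fn_grad ?_ ?_⟩, rfl⟩
  · exact Lp.ext ((fn_ofTest_ae φ).trans hfn.symm)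
  · exact Lp.ext ((grad_ofTest_ae φ).trans hgrad.symm)

theorem eLpNorm_fn_ofTest (φ : 𝓓(Ω, ℝ)) (p : ℝ≥0∞) :
    eLpNorm (fn (ofTest φ)) p (vol Ω) = eLpNorm φ p volume := by
  rw [eLpNorm_congr_ae (fn_ofTest_ae φ),
    eLpNorm_restrict_eq_of_support_subset (support_subset_of_test φ)]

theorem enorm_grad_ofTest (φ : 𝓓(Ω, ℝ)) :
    ‖grad (ofTest φ)‖ₑ = eLpNorm (fderiv ℝ φ) 2 volume := by
  have hsupp : Function.support (fderiv ℝ φ) ⊆ Ω :=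
    (support_fderiv_subset ℝ).trans φ.tsupport_subset
  rw [Lp.enorm_def, eLpNorm_congr_ae (grad_ofTest_ae φ),
    ← eLpNorm_restrict_eq_of_support_subset (f := fderiv ℝ φ) hsupp]
  exact eLpNorm_congr_norm_ae (.of_forall fun x => LinearIsometryEquiv.norm_map _ _)

theorem critExp_pos (hn : 3 ≤ n) : 0 < critExp n := by
  have : (3 : ℝ) ≤ n := by exact_mod_cast hn
  unfold critExp
  apply div_pos <;> linarith

theorem exists_eLpNorm_critExp_le (hn : 3 ≤ n) (Ω : Opens (EuclideanSpace ℝ (Fin n))) :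
    ∃ C : NNReal, ∀ v : H10 Ω,
      eLpNorm (fn v) (ENNReal.ofReal (critExp n)) (vol Ω) ≤ C * ‖grad v‖ₑ := by
  have hn' : (3 : ℝ) ≤ n := by exact_mod_cast hn
  refine ⟨eLpNormLESNormFDerivOfEqInnerConst
    (volume : Measure (EuclideanSpace ℝ (Fin n))) 2, fun v => ?_⟩
  induction v using denseRange_ofTest.induction_on with
  | hp =>
    refine (lowerSemicontinuous_eLpNorm _).isClosed_epigraph.preimage
      (continuous_fn.prodMk ?_)
    exact (ENNReal.continuous_const_mul ENNReal.coe_ne_top).comp continuous_grad.enorm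
  | ih φ =>
    rw [enorm_grad_ofTest, eLpNorm_fn_ofTest]
    refine eLpNorm_le_eLpNorm_fderiv_of_eq_inner (p := 2) (p' := (critExp n).toNNReal) volume
      (φ.contDiff.of_le (by simp)) φ.hasCompactSupport (by norm_num) ?_ ?_
    · rw [finrank_euclideanSpace_fin]
      lia
    · rw [Real.coe_toNNReal _ (critExp_pos hn).le, finrank_euclideanSpace_fin, critExp]
      have : (n : ℝ) - 2 ≠ 0 := by linarith
      have : (n : ℝ) ≠ 0 := by linarith
      push_cast
      field_simp

theorem memLp_critExp (hn : 3 ≤ n) (v : H10 Ω) :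
    MemLp (fn v) (ENNReal.ofReal (critExp n)) (vol Ω) := by
  obtain ⟨C, hC⟩ := exists_eLpNorm_critExp_le hn Ω
  exact ⟨Lp.aestronglyMeasurable _,
    (hC v).trans_lt (ENNReal.mul_lt_top ENNReal.coe_lt_top enorm_lt_top)⟩

/-- The weak derivative of an element of `H¹₀(Ω)` in the direction `e`. -/
def weakDeriv (e : EuclideanSpace ℝ (Fin n)) : H10 Ω →L[ℝ] Lp ℝ 2 (vol Ω) :=
  ((innerSL ℝ e).compLpL 2 _).comp (gradCLM Ω)

theorem weakDeriv_ae (e : EuclideanSpace ℝ (Fin n)) (v : H10 Ω) :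
    weakDeriv e v =ᵐ[vol Ω] fun x => inner ℝ e (grad v x) :=
  ContinuousLinearMap.coeFn_compLpL _ _

theorem weakDeriv_ofTest_ae (e : EuclideanSpace ℝ (Fin n)) (φ : 𝓓(Ω, ℝ)) :
    weakDeriv e (ofTest φ) =ᵐ[vol Ω] fun x => fderiv ℝ φ x e := by
  filter_upwards [weakDeriv_ae e (ofTest φ), grad_ofTest_ae φ] with x hx hgrad
  rw [hx, hgrad, real_inner_comm, gradient, InnerProductSpace.toDual_symm_apply]

theorem inner_weakDeriv_ofTest_fn_ofTest (e : EuclideanSpace ℝ (Fin n)) (φ ψ : 𝓓(Ω, ℝ)) :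
    inner ℝ (weakDeriv e (ofTest φ)) (fn (ofTest ψ)) = ∫ x, ψ x * fderiv ℝ φ x e := by
  rw [L2.inner_def, ← setIntegral_eq_integral_of_forall_compl_eq_zero
    (s := (Ω : Set (EuclideanSpace ℝ (Fin n)))) (f := fun x => ψ x * fderiv ℝ φ x e)]
  · refine integral_congr_ae ?_
    filter_upwards [weakDeriv_ofTest_ae e φ, fn_ofTest_ae ψ] with x hφ hψ
    rw [hφ, hψ, RCLike.inner_apply, conj_trivial]
  · intro x hx
    rw [Function.notMem_support.1 fun h => hx (support_subset_of_test ψ h), zero_mul]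

theorem inner_weakDeriv_fn (e : EuclideanSpace ℝ (Fin n)) (v w : H10 Ω) :
    inner ℝ (weakDeriv e v) (fn w) = -inner ℝ (weakDeriv e w) (fn v) := by
  refine denseRange_ofTest.induction_on₂ (p := fun v w : H10 Ω =>
    inner ℝ (weakDeriv e v) (fn w) = -inner ℝ (weakDeriv e w) (fn v)) ?_ (fun φ ψ => ?_) v w
  · exact isClosed_eq (by fun_prop) (by fun_prop)
  · have hcont (χ : 𝓓(Ω, ℝ)) : Continuous fun x => fderiv ℝ χ x e :=
      (χ.contDiff.continuous_fderiv (by simp)).clm_apply continuous_const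
    rw [inner_weakDeriv_ofTest_fn_ofTest, inner_weakDeriv_ofTest_fn_ofTest]
    simp only [mul_comm (φ _)]
    refine integral_mul_fderiv_eq_neg_fderiv_mul_of_integrable ?_ ?_ ?_
      (fun x _ => ψ.contDiff.differentiable (by simp) x)
      fun x _ => φ.contDiff.differentiable (by simp) x
    · exact ((hcont ψ).mul φ.continuous).integrable_of_hasCompactSupport
        φ.hasCompactSupport.mul_left
    · exact (ψ.continuous.mul (hcont φ)).integrable_of_hasCompactSupport
        ψ.hasCompactSupport.mul_right
    · exact (ψ.continuous.mul φ.continuous).integrable_of_hasCompactSupport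
        ψ.hasCompactSupport.mul_right

theorem eq_zero_of_fn_eq_zero {v : H10 Ω} (h : fn v = 0) : v = 0 := by
  refine ext_fn_grad h ?_
  have hloc : LocallyIntegrableOn (grad v) (Ω : Set (EuclideanSpace ℝ (Fin n))) (vol Ω) :=
    ((Lp.memLp (grad v)).locallyIntegrable (by norm_num)).locallyIntegrableOn _
  have hae : ∀ᵐ x ∂vol Ω, x ∈ Ω → grad v x = 0 := by
    refine Ω.isOpen.ae_eq_zero_of_integral_contDiff_smul_eq_zero hloc fun g hg hgc hgs => ?_
    let ψ : 𝓓(Ω, ℝ) := ⟨g, hg, hgc, hgs⟩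
    have hint : Integrable (fun x => g x • grad v x) (vol Ω) :=
      memLp_one_iff_integrable.1 ((Lp.memLp (grad v)).smul (memLp_of_test ψ 2))
    refine ext_inner_left ℝ fun e => ?_
    calc inner ℝ e (∫ x, g x • grad v x ∂vol Ω)
        = inner ℝ (weakDeriv e v) (fn (ofTest ψ)) := by
          rw [← integral_inner hint, L2.inner_def]
          refine integral_congr_ae ?_
          filter_upwards [weakDeriv_ae e v, fn_ofTest_ae ψ] with x hv hψ
          rw [hv, hψ, real_inner_smul_right, RCLike.inner_apply, conj_trivial]
          rfl
      _ = inner ℝ e 0 := by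
          rw [inner_weakDeriv_fn, h, inner_zero_right, neg_zero, inner_zero_right]
  refine (Lp.eq_zero_iff_ae_eq_zero).2 ?_
  filter_upwards [hae, ae_restrict_mem Ω.isOpen.measurableSet] with x hx hxΩ
  exact hx hxΩ

theorem critNorm_pos (hn : 3 ≤ n) {u : H10 Ω} (hu : u ≠ 0) : 0 < critNorm u := by
  refine lpNorm_nonneg.lt_of_ne' fun h0 => hu (eq_zero_of_fn_eq_zero ?_)
  refine Lp.eq_zero_iff_ae_eq_zero.2
    ((lpNorm_eq_zero (memLp_critExp hn u) ?_).1 h0)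
  simpa using critExp_pos hn

end Sobolev

section Poincare

variable {n : ℕ} {Ω : Opens (EuclideanSpace ℝ (Fin n))}

theorem setIntegral_comp_fn_ofTest (φ : 𝓓(Ω, ℝ)) {g : ℝ → ℝ} (hg : g 0 = 0)
    (Q : Set (EuclideanSpace ℝ (Fin n))) :
    ∫ x in Q, g (fn (ofTest φ) x) ∂vol Ω = ∫ x in Q, g (φ x) := by
  have hzero (x) (hx : x ∉ (Ω : Set (EuclideanSpace ℝ (Fin n)))) : g (φ x) = 0 := by
    rw [Function.notMem_support.1 fun h => hx (support_subset_of_test φ h), hg]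
  calc ∫ x in Q, g (fn (ofTest φ) x) ∂vol Ω = ∫ x in Q, g (φ x) ∂vol Ω :=
        integral_congr_ae (ae_restrict_of_ae ((fn_ofTest_ae φ).fun_comp g))
    _ = ∫ x in Q, g (φ x) := by
        rw [vol, ← Measure.restrict_comm Ω.isOpen.measurableSet]
        exact setIntegral_eq_integral_of_forall_compl_eq_zero hzero

theorem ofReal_sum_variance_fn_le {ι : Type*} (J : Finset ι)
    {Q : ι → Set (EuclideanSpace ℝ (Fin n))} (hQ : ∀ i ∈ J, MeasurableSet (Q i))
    (hQv : ∀ i ∈ J, volume (Q i) ≠ ⊤) (hdisj : (J : Set ι).PairwiseDisjoint Q) {d : NNReal}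
    (hdiam : ∀ i ∈ J, ∀ x ∈ Q i, ∀ y ∈ Q i, ‖y - x‖ ≤ d) (v : H10 Ω) :
    ENNReal.ofReal (∑ i ∈ J, 2 * (volume.real (Q i) * ∫ x in Q i, fn v x ^ 2 ∂vol Ω -
        (∫ x in Q i, fn v x ∂vol Ω) ^ 2)) ≤
      volume (Metric.closedBall (0 : EuclideanSpace ℝ (Fin n)) d) * (d * ‖grad v‖ₑ) ^ 2 := by
  have hmean (i) (hi : i ∈ J) :
      Continuous fun v : H10 Ω => ∫ x in Q i, fn v x ∂vol Ω := by
    have hQΩ : vol Ω (Q i) ≠ ⊤ := ne_top_of_le_ne_top (hQv i hi) (Measure.restrict_apply_le _ _)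
    simp only [← setIntegralCLM_apply (hQ i hi) hQΩ]
    exact (setIntegralCLM (hQ i hi) hQΩ).continuous.comp continuous_fn
  induction v using denseRange_ofTest.induction_on with
  | hp =>
    refine isClosed_le (ENNReal.continuous_ofReal.comp (continuous_finsetSum _ fun i hi => ?_)) ?_
    · exact ((((continuous_setIntegral_sq _).comp continuous_fn).const_mul _).sub
        ((hmean i hi).pow 2)).const_mul 2
    · refine (ENNReal.continuous_const_mul measure_closedBall_lt_top.ne).comp ?_
      exact (ENNReal.continuous_pow 2).comp
        ((ENNReal.continuous_const_mul ENNReal.coe_ne_top).comp continuous_grad.enorm)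
  | ih φ =>
    rw [enorm_grad_ofTest]
    have hsq (i) := setIntegral_comp_fn_ofTest φ (g := (· ^ 2)) (zero_pow two_ne_zero) (Q i)
    have hid (i) := setIntegral_comp_fn_ofTest φ (g := id) rfl (Q i)
    simp only [id] at hsq hid
    simp only [hsq, hid]
    exact ofReal_sum_variance_le volume (φ.contDiff.of_le (by simp)) φ.hasCompactSupport J hQ hQv
      hdisj hdiam

theorem eLpNorm_fn_biUnion_le {ι : Type*} {J : Finset ι}
    {Q : ι → Set (EuclideanSpace ℝ (Fin n))} (hQ : ∀ i ∈ J, MeasurableSet (Q i))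
    {c : NNReal} (hQv : ∀ i ∈ J, volume (Q i) = c) (hdisj : (J : Set ι).PairwiseDisjoint Q)
    {d : NNReal} (hdiam : ∀ i ∈ J, ∀ x ∈ Q i, ∀ y ∈ Q i, ‖y - x‖ ≤ d) {v : H10 Ω}
    (hv : ∀ i ∈ J, ∫ x in Q i, fn v x ∂vol Ω = 0) :
    c * eLpNorm (fn v) 2 ((vol Ω).restrict (⋃ i ∈ J, Q i)) ^ 2 ≤
      volume (Metric.closedBall (0 : EuclideanSpace ℝ (Fin n)) d) * (d * ‖grad v‖ₑ) ^ 2 := by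
  have hcell (i) : 0 ≤ ∫ x in Q i, fn v x ^ 2 ∂vol Ω := integral_nonneg fun x => sq_nonneg _
  rw [eLpNorm_two_sq, lintegral_biUnion_finset hdisj hQ, Finset.mul_sum]
  refine le_trans ?_ (ofReal_sum_variance_fn_le J hQ
    (fun i hi => (hQv i hi).trans_ne ENNReal.coe_ne_top) hdisj hdiam v)
  rw [ENNReal.ofReal_sum_of_nonneg fun i hi => by
    rw [hv i hi]
    simpa using mul_nonneg measureReal_nonneg (hcell i)]
  refine Finset.sum_le_sum fun i hi => ?_
  rw [← ofReal_integral_sq ((Lp.memLp _).restrict _), hv i hi, Measure.real, hQv i hi,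
    ENNReal.coe_toReal, ← ENNReal.ofReal_coe_nnreal, ← ENNReal.ofReal_mul c.coe_nonneg]
  refine ENNReal.ofReal_le_ofReal ?_
  linarith [mul_nonneg c.coe_nonneg (hcell i)]

/-- The half-open cube of side `1 / m` with lower corner `z / m`. -/
def gridCube (m : ℕ) [NeZero m] (z : Fin n → ℤ) : Set (EuclideanSpace ℝ (Fin n)) :=
  WithLp.ofLp ⁻¹' (BoxIntegral.unitPartition.box m z : Set (Fin n → ℝ))

theorem measurableSet_gridCube (m : ℕ) [NeZero m] (z : Fin n → ℤ) :
    MeasurableSet (gridCube m z) :=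
  (PiLp.volume_preserving_ofLp (Fin n)).measurable (BoxIntegral.Box.measurableSet_coe _)

theorem volume_gridCube (m : ℕ) [NeZero m] (z : Fin n → ℤ) :
    volume (gridCube m z) = 1 / (m : ℝ≥0∞) ^ n := by
  rw [gridCube, (PiLp.volume_preserving_ofLp (Fin n)).measure_preimage
    (BoxIntegral.Box.measurableSet_coe _).nullMeasurableSet,
    BoxIntegral.unitPartition.volume_box, Fintype.card_fin]

theorem pairwiseDisjoint_gridCube (m : ℕ) [NeZero m] (s : Set (Fin n → ℤ)) :
    s.PairwiseDisjoint (gridCube m) := fun _ _ _ _ hne =>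
  (BoxIntegral.unitPartition.disjoint.1 hne).preimage _

theorem norm_sub_le_of_mem_gridCube {m : ℕ} [NeZero m] {z : Fin n → ℤ}
    {x y : EuclideanSpace ℝ (Fin n)} (hx : x ∈ gridCube m z) (hy : y ∈ gridCube m z) :
    ‖y - x‖ ≤ (1 / m) * √n := by
  have hcoord (i : Fin n) : ‖(y - x) i‖ ^ 2 ≤ (1 / m : ℝ) ^ 2 := by
    have hxi := BoxIntegral.unitPartition.mem_box_iff.1 hx i
    have hyi := BoxIntegral.unitPartition.mem_box_iff.1 hy i
    rw [add_div] at hxi hyi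
    rw [Real.norm_eq_abs, sq_abs, PiLp.sub_apply]
    apply sq_le_sq' <;> linarith [hxi.1, hxi.2, hyi.1, hyi.2]
  calc ‖y - x‖ = √(∑ i, ‖(y - x) i‖ ^ 2) := EuclideanSpace.norm_eq _
    _ ≤ √(∑ _i : Fin n, (1 / m : ℝ) ^ 2) :=
        Real.sqrt_le_sqrt (Finset.sum_le_sum fun i _ => hcoord i)
    _ = (1 / m) * √n := by
        rw [Finset.sum_const, Finset.card_univ, Fintype.card_fin, nsmul_eq_mul, mul_comm,
          Real.sqrt_mul (by positivity), Real.sqrt_sq (by positivity)]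

theorem exists_subset_biUnion_gridCube (m : ℕ) [NeZero m] {B : Set (EuclideanSpace ℝ (Fin n))}
    (hB : Bornology.IsBounded B) : ∃ J : Finset (Fin n → ℤ), B ⊆ ⋃ z ∈ J, gridCube m z := by
  obtain ⟨I, hI, hBI⟩ := BoxIntegral.le_hasIntegralVertices_of_isBounded
    ((PiLp.lipschitzWith_ofLp 2 fun _ : Fin n => ℝ).isBounded_image hB)
  refine ⟨BoxIntegral.unitPartition.admissibleIndex m I, fun x hx => Set.mem_iUnion₂.2
    ⟨_, BoxIntegral.unitPartition.mem_admissibleIndex_of_mem_box m hI (hBI ⟨x, hx, rfl⟩),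
      BoxIntegral.unitPartition.mem_box_iff_index.2 rfl⟩⟩

theorem exists_eLpNorm_fn_gridCubes_le (Ω : Opens (EuclideanSpace ℝ (Fin n))) :
    ∃ C : NNReal, ∀ (m : ℕ) [NeZero m] (J : Finset (Fin n → ℤ)) (v : H10 Ω),
      (∀ z ∈ J, ∫ x in gridCube m z, fn v x ∂vol Ω = 0) →
      eLpNorm (fn v) 2 ((vol Ω).restrict (⋃ z ∈ J, gridCube m z)) ≤
        (C / m : NNReal) * ‖grad v‖ₑ := by
  obtain ⟨κ, hκ⟩ : ∃ κ : NNReal,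
      (κ : ℝ≥0∞) = volume (Metric.closedBall (0 : EuclideanSpace ℝ (Fin n)) √n) :=
    ⟨_, ENNReal.coe_toNNReal measure_closedBall_lt_top.ne⟩
  refine ⟨NNReal.sqrt κ * NNReal.sqrt n, fun m _ J v hv => ?_⟩
  have hm : (m : NNReal) ≠ 0 := NeZero.ne _
  have hvol (z) : volume (gridCube (n := n) m z) = ((1 / m : NNReal) ^ n : NNReal) := by
    rw [volume_gridCube, one_div, one_div]
    push_cast [ENNReal.coe_inv hm, ENNReal.inv_pow]
    rfl
  have hball : volume (Metric.closedBall (0 : EuclideanSpace ℝ (Fin n))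
      (1 / m * NNReal.sqrt n : NNReal)) = ((1 / m : NNReal) ^ n : NNReal) * (κ : ℝ≥0∞) := by
    rw [NNReal.coe_mul, Measure.addHaar_closedBall_mul _ _ NNReal.zero_le_coe NNReal.zero_le_coe,
      Real.coe_sqrt, NNReal.coe_natCast, ← hκ, finrank_euclideanSpace_fin, ← NNReal.coe_pow,
      ENNReal.ofReal_coe_nnreal]
  have hle := eLpNorm_fn_biUnion_le (fun z _ => measurableSet_gridCube m z) (fun z _ => hvol z)
    (pairwiseDisjoint_gridCube m _) (d := 1 / m * NNReal.sqrt n)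
    (fun z _ x hx y hy => by simpa using norm_sub_le_of_mem_gridCube hx hy) hv
  rw [hball, mul_assoc, ENNReal.mul_le_mul_iff_right (by positivity) ENNReal.coe_ne_top] at hle
  refine (ENNReal.pow_le_pow_left_iff two_ne_zero).1 (hle.trans_eq ?_)
  rw [mul_pow, mul_pow, ← mul_assoc]
  congr 1
  rw [← ENNReal.coe_pow, ← ENNReal.coe_pow, ← ENNReal.coe_mul, ENNReal.coe_inj,
    ← NNReal.sq_sqrt κ, NNReal.sqrt_sq]
  ring

theorem exists_coFG_eLpNorm_fn_restrict_le {B : Set (EuclideanSpace ℝ (Fin n))}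
    (hB : Bornology.IsBounded B) {ε : NNReal} (hε : 0 < ε) :
    ∃ L : Submodule ℝ (H10 Ω), L.CoFG ∧
      ∀ v ∈ L, eLpNorm (fn v) 2 ((vol Ω).restrict B) ≤ ε * ‖grad v‖ₑ := by
  obtain ⟨C, hC⟩ := exists_eLpNorm_fn_gridCubes_le Ω
  obtain ⟨m, hm⟩ := exists_nat_gt (C / ε)
  have : NeZero m := ⟨by rintro rfl; simp at hm⟩
  have hCm : C / m ≤ ε := (div_le_comm₀ (by exact_mod_cast NeZero.pos m) hε).2 hm.le
  obtain ⟨J, hJ⟩ := exists_subset_biUnion_gridCube m hB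
  have hfin (z : Fin n → ℤ) : vol Ω (gridCube m z) ≠ ⊤ := by
    refine ne_top_of_le_ne_top ?_ (Measure.restrict_apply_le _ _)
    simp [volume_gridCube, NeZero.ne m]
  let means : H10 Ω →ₗ[ℝ] J → ℝ := LinearMap.pi fun z =>
    (setIntegralCLM (measurableSet_gridCube m z.1) (hfin z)).toLinearMap ∘ₗ (fnCLM Ω).toLinearMap
  refine ⟨LinearMap.ker means, .ker _, fun v hv => ?_⟩
  have hmean (z) (hz : z ∈ J) : ∫ x in gridCube m z, fn v x ∂vol Ω = 0 := by
    rw [← setIntegralCLM_apply (measurableSet_gridCube m z) (hfin z)]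
    exact congrFun (LinearMap.mem_ker.1 hv) ⟨z, hz⟩
  calc eLpNorm (fn v) 2 ((vol Ω).restrict B)
      ≤ eLpNorm (fn v) 2 ((vol Ω).restrict (⋃ z ∈ J, gridCube m z)) :=
        eLpNorm_mono_measure _ (Measure.restrict_mono hJ le_rfl)
    _ ≤ (C / m : NNReal) * ‖grad v‖ₑ := hC m J v hmean
    _ ≤ ε * ‖grad v‖ₑ := by gcongr

end Poincare

section Weight

variable {n : ℕ} {Ω : Opens (EuclideanSpace ℝ (Fin n))}

theorem holderTriple_critExp (hn : 3 ≤ n) :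
    ENNReal.HolderTriple (ENNReal.ofReal n) (ENNReal.ofReal (critExp n)) 2 := by
  have hn' : (3 : ℝ) ≤ n := by exact_mod_cast hn
  have : (n : ℝ) - 2 ≠ 0 := by linarith
  have hn0 : (n : ℝ) ≠ 0 := by linarith
  refine ⟨?_⟩
  rw [← ENNReal.ofReal_inv_of_pos (by linarith), ← ENNReal.ofReal_inv_of_pos (critExp_pos hn),
    ← ENNReal.ofReal_add (by positivity) (inv_nonneg.2 (critExp_pos hn).le),
    ← ENNReal.ofReal_ofNat 2, ← ENNReal.ofReal_inv_of_pos two_pos, critExp]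
  congr 1
  field_simp
  ring

theorem eLpNorm_mul_fn_le (hn : 3 ≤ n) {C : NNReal}
    (hC : ∀ v : H10 Ω, eLpNorm (fn v) (ENNReal.ofReal (critExp n)) (vol Ω) ≤ C * ‖grad v‖ₑ)
    {g : EuclideanSpace ℝ (Fin n) → ℝ} (hg : AEStronglyMeasurable g (vol Ω)) (v : H10 Ω) :
    eLpNorm (fun x => g x * fn v x) 2 (vol Ω) ≤
      eLpNorm g (ENNReal.ofReal n) (vol Ω) * (C * ‖grad v‖ₑ) :=
  have := holderTriple_critExp hn
  (eLpNorm_smul_le_mul_eLpNorm (Lp.aestronglyMeasurable (fn v)) hg).trans (by gcongr; exact hC v)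

theorem memLp_mul_fn (hn : 3 ≤ n) {g : EuclideanSpace ℝ (Fin n) → ℝ}
    (hg : MemLp g (ENNReal.ofReal n) (vol Ω)) (v : H10 Ω) :
    MemLp (fun x => g x * fn v x) 2 (vol Ω) :=
  have := holderTriple_critExp hn
  (memLp_critExp hn v).mul' hg

/-- Multiplication by a function of `Lⁿ(Ω)`, as a linear map from `H¹₀(Ω)` to `L²(Ω)`. -/
def weightMulₗ (hn : 3 ≤ n) {g : EuclideanSpace ℝ (Fin n) → ℝ}
    (hg : MemLp g (ENNReal.ofReal n) (vol Ω)) : H10 Ω →ₗ[ℝ] Lp ℝ 2 (vol Ω) where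
  toFun v := (memLp_mul_fn hn hg v).toLp
  map_add' v v' := by
    rw [← MemLp.toLp_add]
    refine MemLp.toLp_congr _ _ ?_
    filter_upwards [Lp.coeFn_add (fn v) (fn v')] with x hx
    rw [← fnCLM_apply, map_add, fnCLM_apply, fnCLM_apply, hx]
    exact mul_add _ _ _
  map_smul' c v := by
    rw [RingHom.id_apply, ← MemLp.toLp_const_smul]
    refine MemLp.toLp_congr _ _ ?_
    filter_upwards [Lp.coeFn_smul c (fn v)] with x hx
    rw [← fnCLM_apply, map_smul, fnCLM_apply, hx]
    exact mul_left_comm _ _ _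

theorem enorm_weightMulₗ (hn : 3 ≤ n) {g : EuclideanSpace ℝ (Fin n) → ℝ}
    (hg : MemLp g (ENNReal.ofReal n) (vol Ω)) (v : H10 Ω) :
    ‖weightMulₗ hn hg v‖ₑ = eLpNorm (fun x => g x * fn v x) 2 (vol Ω) :=
  Lp.enorm_toLp (memLp_mul_fn hn hg v)

theorem exists_norm_weightMulₗ_le (hn : 3 ≤ n) {g : EuclideanSpace ℝ (Fin n) → ℝ}
    (hg : MemLp g (ENNReal.ofReal n) (vol Ω)) :
    ∃ C : ℝ, ∀ v : H10 Ω, ‖weightMulₗ hn hg v‖ ≤ C * ‖v‖ := by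
  obtain ⟨C, hC⟩ := exists_eLpNorm_critExp_le hn Ω
  obtain ⟨G, hG⟩ : ∃ G : NNReal, (G : ℝ≥0∞) = eLpNorm g (ENNReal.ofReal n) (vol Ω) :=
    ⟨_, ENNReal.coe_toNNReal hg.2.ne⟩
  refine ⟨G * C * ‖gradCLM Ω‖, fun v => ?_⟩
  have hle := eLpNorm_mul_fn_le hn hC hg.1 v
  rw [← enorm_weightMulₗ hn hg, ← hG, ← mul_assoc, ← ENNReal.coe_mul,
    enorm_le_coe_mul_enorm_iff] at hle
  calc ‖weightMulₗ hn hg v‖ ≤ G * C * ‖grad v‖ := hle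
    _ ≤ G * C * (‖gradCLM Ω‖ * ‖v‖) := by
        gcongr
        exact (gradCLM Ω).le_opNorm v
    _ = G * C * ‖gradCLM Ω‖ * ‖v‖ := (mul_assoc _ _ _).symm

/-- `weightMulₗ` as a continuous linear map. -/
def weightMul (hn : 3 ≤ n) {g : EuclideanSpace ℝ (Fin n) → ℝ}
    (hg : MemLp g (ENNReal.ofReal n) (vol Ω)) : H10 Ω →L[ℝ] Lp ℝ 2 (vol Ω) :=
  (weightMulₗ hn hg).mkContinuousOfExistsBound (exists_norm_weightMulₗ_le hn hg)

theorem weightMul_ae (hn : 3 ≤ n) {g : EuclideanSpace ℝ (Fin n) → ℝ}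
    (hg : MemLp g (ENNReal.ofReal n) (vol Ω)) (v : H10 Ω) :
    weightMul hn hg v =ᵐ[vol Ω] fun x => g x * fn v x :=
  (memLp_mul_fn hn hg v).coeFn_toLp

theorem enorm_weightMul (hn : 3 ≤ n) {g : EuclideanSpace ℝ (Fin n) → ℝ}
    (hg : MemLp g (ENNReal.ofReal n) (vol Ω)) (v : H10 Ω) :
    ‖weightMul hn hg v‖ₑ = eLpNorm (fun x => g x * fn v x) 2 (vol Ω) :=
  enorm_weightMulₗ hn hg v

theorem exists_coFG_eLpNorm_mul_fn_le {h : EuclideanSpace ℝ (Fin n) → ℝ} (hh : Continuous h)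
    (hhc : HasCompactSupport h) {ε : NNReal} (hε : 0 < ε) :
    ∃ L : Submodule ℝ (H10 Ω), L.CoFG ∧
      ∀ v ∈ L, eLpNorm (fun x => h x * fn v x) 2 (vol Ω) ≤ ε * ‖grad v‖ₑ := by
  obtain ⟨M, hM⟩ : ∃ M : NNReal, ∀ x, ‖h x‖₊ ≤ M :=
    have ⟨M, hM⟩ := hh.bounded_above_of_compact_support hhc
    ⟨M.toNNReal, fun x => NNReal.le_toNNReal_of_coe_le (hM x)⟩
  obtain ⟨L, hL, hLv⟩ := exists_coFG_eLpNorm_fn_restrict_le (Ω := Ω)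
    hhc.isCompact.isBounded (ε := ε / (M + 1)) (by positivity)
  refine ⟨L, hL, fun v hv => ?_⟩
  have hsupp : Function.support (fun x => h x * fn v x) ⊆ tsupport h :=
    (Function.support_mul_subset_left _ _).trans (subset_tsupport h)
  calc eLpNorm (fun x => h x * fn v x) 2 (vol Ω)
      = eLpNorm (fun x => h x * fn v x) 2 ((vol Ω).restrict (tsupport h)) :=
        (eLpNorm_restrict_eq_of_support_subset hsupp).symm
    _ ≤ M • eLpNorm (fn v) 2 ((vol Ω).restrict (tsupport h)) := by
        refine eLpNorm_le_nnreal_smul_eLpNorm_of_ae_le_mul (.of_forall fun x => ?_) 2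
        rw [nnnorm_mul]
        gcongr
        exact hM x
    _ ≤ (M + 1 : NNReal) * ((ε / (M + 1) : NNReal) * ‖grad v‖ₑ) := by
        rw [ENNReal.smul_def, smul_eq_mul]
        gcongr
        · exact le_self_add
        · exact hLv v hv
    _ = ε * ‖grad v‖ₑ := by
        rw [← mul_assoc, ← ENNReal.coe_mul, mul_div_cancel₀ ε (by positivity : M + 1 ≠ 0)]

theorem exists_coFG_norm_weightMul_le (hn : 3 ≤ n) {g : EuclideanSpace ℝ (Fin n) → ℝ}
    (hg : MemLp g (ENNReal.ofReal n) (vol Ω)) {ε : NNReal} (hε : 0 < ε) :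
    ∃ L : Submodule ℝ (H10 Ω), L.CoFG ∧ ∀ v ∈ L, ‖weightMul hn hg v‖ ≤ ε * ‖grad v‖ := by
  obtain ⟨C, hC⟩ := exists_eLpNorm_critExp_le hn Ω
  obtain ⟨δ, hδ, hδC⟩ : ∃ δ : NNReal, 0 < δ ∧ δ * C ≤ ε / 2 := by
    refine ⟨ε / 2 / (C + 1), by positivity, ?_⟩
    rw [div_mul_eq_mul_div, div_le_iff₀ (by positivity)]
    gcongr
    exact le_self_add
  obtain ⟨h, hhc, hgh, hh, -⟩ := hg.exists_hasCompactSupport_eLpNorm_sub_le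
    ENNReal.ofReal_ne_top (ε := δ) (by exact_mod_cast hδ.ne')
  obtain ⟨L, hL, hLv⟩ := exists_coFG_eLpNorm_mul_fn_le (Ω := Ω) hh hhc (half_pos hε)
  refine ⟨L, hL, fun v hv => enorm_le_coe_mul_enorm_iff.1 ?_⟩
  have hghm : AEStronglyMeasurable (g - h) (vol Ω) := hg.1.sub hh.aestronglyMeasurable
  calc ‖weightMul hn hg v‖ₑ
      = eLpNorm ((fun x => (g - h) x * fn v x) + fun x => h x * fn v x) 2 (vol Ω) := by
        rw [enorm_weightMul]
        congr with x
        simp [sub_mul]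
    _ ≤ eLpNorm (fun x => (g - h) x * fn v x) 2 (vol Ω) +
          eLpNorm (fun x => h x * fn v x) 2 (vol Ω) :=
        eLpNorm_add_le (hghm.mul (Lp.aestronglyMeasurable _))
          (hh.aestronglyMeasurable.mul (Lp.aestronglyMeasurable _)) one_le_two
    _ ≤ δ * (C * ‖grad v‖ₑ) + (ε / 2 : NNReal) * ‖grad v‖ₑ := by
        gcongr
        · exact (eLpNorm_mul_fn_le hn hC hghm v).trans (by gcongr)
        · exact hLv v hv
    _ ≤ ε * ‖grad v‖ₑ := by
        rw [← mul_assoc, ← add_mul]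
        gcongr
        norm_cast
        exact (add_le_add_left hδC _).trans_eq (add_halves ε)

end Weight

section InfiniteRank

variable {n : ℕ} {Ω : Opens (EuclideanSpace ℝ (Fin n))}

theorem ae_eval_coord_ne_zero {p : Polynomial ℝ} (hp : p ≠ 0) (i : Fin n) :
    ∀ᵐ x : EuclideanSpace ℝ (Fin n), p.eval (x i) ≠ 0 := by
  have hcoord : Measure.QuasiMeasurePreserving fun x : EuclideanSpace ℝ (Fin n) => x i :=
    (Measure.quasiMeasurePreserving_eval (fun _ => volume) i).comp
      (PiLp.volume_preserving_ofLp (Fin n)).quasiMeasurePreserving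
  refine hcoord.ae (p := fun t => p.eval t ≠ 0) ?_
  simpa only [ae_iff, not_not, Polynomial.IsRoot.def] using
    (p.finite_setOfPred_isRoot hp).measure_zero volume

/-- The test function `x ↦ p(xᵢ) φ(x)`. -/
def polynomialMulTest (i : Fin n) (φ : 𝓓(Ω, ℝ)) (p : Polynomial ℝ) : 𝓓(Ω, ℝ) where
  toFun x := p.eval (x i) * φ x
  contDiff' := ((p.contDiff_aeval ∞).comp (by fun_prop)).mul φ.contDiff
  hasCompactSupport' := φ.hasCompactSupport.mul_left
  tsupport_subset' := (tsupport_mul_subset_right).trans φ.tsupport_subset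

theorem fn_injective : Function.Injective (fn : H10 Ω → Lp ℝ 2 (vol Ω)) :=
  (injective_iff_map_eq_zero (fnCLM Ω)).2 fun _ => eq_zero_of_fn_eq_zero

/-- `polynomialMulTest` as a linear map from polynomials to `H¹₀(Ω)`. -/
def polynomialMul (i : Fin n) (φ : 𝓓(Ω, ℝ)) : Polynomial ℝ →ₗ[ℝ] H10 Ω where
  toFun p := ofTest (polynomialMulTest i φ p)
  map_add' p q := fn_injective <| Lp.ext <| by
    refine (fn_ofTest_ae _).trans ?_
    filter_upwards [fn_ofTest_ae (polynomialMulTest i φ p), fn_ofTest_ae (polynomialMulTest i φ q),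
      Lp.coeFn_add (fn (ofTest (polynomialMulTest i φ p)))
        (fn (ofTest (polynomialMulTest i φ q)))] with x hp hq hadd
    refine Eq.trans ?_ hadd.symm
    rw [Pi.add_apply, hp, hq]
    exact (congrArg (· * φ x) Polynomial.eval_add).trans (add_mul _ _ _)
  map_smul' c p := fn_injective <| Lp.ext <| by
    refine (fn_ofTest_ae _).trans ?_
    filter_upwards [fn_ofTest_ae (polynomialMulTest i φ p),
      Lp.coeFn_smul c (fn (ofTest (polynomialMulTest i φ p)))] with x hp hsmul
    refine Eq.trans ?_ hsmul.symm
    rw [Pi.smul_apply, hp]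
    exact (congrArg (· * φ x) (Polynomial.eval_smul _ _ _)).trans (mul_assoc _ _ _)

theorem fn_polynomialMul_ae (i : Fin n) (φ : 𝓓(Ω, ℝ)) (p : Polynomial ℝ) :
    fn (polynomialMul i φ p) =ᵐ[vol Ω] fun x => p.eval (x i) * φ x :=
  fn_ofTest_ae _

theorem exists_test_mul_not_ae_eq_zero {g : EuclideanSpace ℝ (Fin n) → ℝ}
    (hg : LocallyIntegrable g (vol Ω)) (hg0 : ¬ g =ᵐ[vol Ω] 0) :
    ∃ φ : 𝓓(Ω, ℝ), ¬ (fun x => g x * φ x) =ᵐ[vol Ω] 0 := by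
  contrapose! hg0
  have hae : ∀ᵐ x ∂vol Ω, x ∈ Ω → g x = 0 := by
    refine Ω.isOpen.ae_eq_zero_of_integral_contDiff_smul_eq_zero (hg.locallyIntegrableOn _)
      fun f hf hfc hfs => integral_eq_zero_of_ae ?_
    filter_upwards [hg0 ⟨f, hf, hfc, hfs⟩] with x hx
    exact (mul_comm _ _).trans hx
  filter_upwards [hae, ae_restrict_mem Ω.isOpen.measurableSet] with x hx hxΩ
  exact hx hxΩ

theorem not_fg_range_weightMul (hn : 3 ≤ n) {g : EuclideanSpace ℝ (Fin n) → ℝ}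
    (hg : MemLp g (ENNReal.ofReal n) (vol Ω)) (hg0 : ¬ g =ᵐ[vol Ω] 0) :
    ¬ (LinearMap.range (weightMul hn hg).toLinearMap).FG := by
  intro hfg
  have : Module.Finite ℝ (LinearMap.range (weightMul hn hg).toLinearMap) :=
    Module.Finite.iff_fg.2 hfg
  let i : Fin n := ⟨0, by lia⟩
  have hn1 : (1 : ℝ≥0∞) ≤ ENNReal.ofReal n := by
    rw [ENNReal.one_le_ofReal]
    exact_mod_cast (by lia : 1 ≤ n)
  obtain ⟨φ, hφ⟩ := exists_test_mul_not_ae_eq_zero (hg.locallyIntegrable hn1) hg0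
  have hinj : Function.Injective
      ((weightMul hn hg).toLinearMap.rangeRestrict ∘ₗ polynomialMul i φ) := by
    refine (injective_iff_map_eq_zero _).2 fun p hp => by_contra fun hp0 => hφ ?_
    have hTp : weightMul hn hg (polynomialMul i φ p) = 0 := congrArg Subtype.val hp
    filter_upwards [weightMul_ae hn hg (polynomialMul i φ p), fn_polynomialMul_ae i φ p,
      Lp.eq_zero_iff_ae_eq_zero.1 hTp, ae_restrict_of_ae (ae_eval_coord_ne_zero hp0 i)]
      with x hmul hpφ hzero hpx
    rw [hmul, hpφ, mul_left_comm] at hzero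
    exact (mul_eq_zero.1 hzero).resolve_left hpx
  exact Polynomial.not_finite (Module.Finite.of_injective _ hinj)

end InfiniteRank

section Energy

variable {n : ℕ} {Ω : Opens (EuclideanSpace ℝ (Fin n))}

/-- The bilinear form `∫ ∇v·∇w - lam ∫ v w` of the operator `-Δ - lam` on `H¹₀(Ω)`. -/
def energyForm (Ω : Opens (EuclideanSpace ℝ (Fin n))) (lam : ℝ) : H10 Ω →L[ℝ] H10 Ω →L[ℝ] ℝ :=
  shiftedForm (pullbackInner (gradCLM Ω)) (fnCLM Ω) lam

theorem energyForm_apply (lam : ℝ) (v v' : H10 Ω) :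
    energyForm Ω lam v v' = inner ℝ (grad v) (grad v') - lam * inner ℝ (fn v) (fn v') := rfl

theorem energyForm_apply_self (lam : ℝ) (v : H10 Ω) :
    energyForm Ω lam v v = ‖grad v‖ ^ 2 - lam * ‖fn v‖ ^ 2 := by
  rw [energyForm_apply, real_inner_self_eq_norm_sq, real_inner_self_eq_norm_sq]

theorem energyForm_comm (lam : ℝ) (v v' : H10 Ω) :
    energyForm Ω lam v v' = energyForm Ω lam v' v := by
  rw [energyForm_apply, energyForm_apply, real_inner_comm, real_inner_comm (fn v')]

theorem energyForm_eq_integral (lam : ℝ) (v v' : H10 Ω) : energyForm Ω lam v v' =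
    (∫ x, inner ℝ (grad v x) (grad v' x) ∂vol Ω) - lam * ∫ x, fn v x * fn v' x ∂vol Ω := by
  rw [energyForm_apply, L2.inner_def, L2.inner_def]
  simp only [RCLike.inner_apply, conj_trivial, mul_comm (fn v' _)]

theorem energyForm_self_eq_integral (lam : ℝ) (v : H10 Ω) :
    energyForm Ω lam v v = ∫ x, (‖grad v x‖ ^ 2 - lam * fn v x ^ 2) ∂vol Ω := by
  have hgrad : Integrable (fun x => ‖grad v x‖ ^ 2) (vol Ω) :=
    (Lp.memLp (grad v)).integrable_norm_pow two_ne_zero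
  have hfn : Integrable (fun x => fn v x ^ 2) (vol Ω) := (Lp.memLp (fn v)).integrable_sq
  rw [integral_sub hgrad (hfn.const_mul lam), integral_const_mul, energyForm_eq_integral]
  simp only [real_inner_self_eq_norm_sq, ← sq]

theorem inner_weightMul_eq_integral (hn : 3 ≤ n) {g : EuclideanSpace ℝ (Fin n) → ℝ}
    (hg : MemLp g (ENNReal.ofReal n) (vol Ω)) (v v' : H10 Ω) :
    inner ℝ (weightMul hn hg v) (weightMul hn hg v') =
      ∫ x, g x ^ 2 * fn v x * fn v' x ∂vol Ω := by
  rw [L2.inner_def]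
  refine integral_congr_ae ?_
  filter_upwards [weightMul_ae hn hg v, weightMul_ae hn hg v'] with x hv hv'
  rw [hv, hv', RCLike.inner_apply, conj_trivial]
  ring

theorem exists_coFG_norm_fn_le (hn : 3 ≤ n)
    (hΩ : volume (Ω : Set (EuclideanSpace ℝ (Fin n))) ≠ ⊤) {ε : NNReal} (hε : 0 < ε) :
    ∃ L : Submodule ℝ (H10 Ω), L.CoFG ∧ ∀ v ∈ L, ‖fn v‖ ≤ ε * ‖grad v‖ := by
  have : IsFiniteMeasure (vol Ω) := isFiniteMeasure_restrict.2 hΩ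
  have hone : MemLp (fun _ => (1 : ℝ)) (ENNReal.ofReal n) (vol Ω) := memLp_const 1
  obtain ⟨L, hL, hLv⟩ := exists_coFG_norm_weightMul_le hn hone hε
  have hmul (v : H10 Ω) : weightMul hn hone v = fn v :=
    Lp.ext ((weightMul_ae hn hone v).trans (.of_forall fun x => one_mul _))
  exact ⟨L, hL, fun v hv => hmul v ▸ hLv v hv⟩

theorem exists_coFG_shiftedForm_energyForm_nonneg (hn : 3 ≤ n)
    (hΩ : volume (Ω : Set (EuclideanSpace ℝ (Fin n))) ≠ ⊤)
    {g : EuclideanSpace ℝ (Fin n) → ℝ} (hg : MemLp g (ENNReal.ofReal n) (vol Ω)) (lam μ : ℝ) :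
    ∃ L : Submodule ℝ (H10 Ω), L.CoFG ∧
      ∀ v ∈ L, 0 ≤ shiftedForm (energyForm Ω lam) (weightMul hn hg) μ v v := by
  obtain ⟨ε, hε, hsmall⟩ : ∃ ε : NNReal, 0 < ε ∧ (|lam| + |μ|) * (ε : ℝ) ^ 2 ≤ 1 := by
    refine ⟨NNReal.sqrt (‖lam‖₊ + ‖μ‖₊ + 1)⁻¹, by positivity, ?_⟩
    rw [← NNReal.coe_pow, NNReal.sq_sqrt, NNReal.coe_inv, ← div_eq_mul_inv,
      div_le_one (by positivity)]
    simp
  obtain ⟨L, hL, hfn⟩ := exists_coFG_norm_fn_le hn hΩ hε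
  obtain ⟨L', hL', hmul⟩ := exists_coFG_norm_weightMul_le hn hg hε
  refine ⟨L ⊓ L', hL.inf hL', fun v hv => ?_⟩
  have hlam : lam * ‖fn v‖ ^ 2 ≤ |lam| * (ε * ‖grad v‖) ^ 2 := by
    gcongr
    exacts [le_abs_self lam, hfn v hv.1]
  have hμ : μ * ‖weightMul hn hg v‖ ^ 2 ≤ |μ| * (ε * ‖grad v‖) ^ 2 := by
    gcongr
    exacts [le_abs_self μ, hmul v hv.2]
  rw [shiftedForm_apply_self, energyForm_apply_self]
  calc (0 : ℝ) ≤ (1 - (|lam| + |μ|) * ε ^ 2) * ‖grad v‖ ^ 2 :=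
        mul_nonneg (sub_nonneg.2 hsmall) (sq_nonneg _)
    _ = ‖grad v‖ ^ 2 - |lam| * (ε * ‖grad v‖) ^ 2 - |μ| * (ε * ‖grad v‖) ^ 2 := by ring
    _ ≤ ‖grad v‖ ^ 2 - lam * ‖fn v‖ ^ 2 - μ * ‖weightMul hn hg v‖ ^ 2 := by gcongr

end Energy

section CriticalWeight

variable {n : ℕ} {Ω : Opens (EuclideanSpace ℝ (Fin n))}

theorem rpow_two_div_sq (hn : 3 ≤ n) {t : ℝ} (ht : 0 ≤ t) :
    (t ^ (2 / ((n : ℝ) - 2))) ^ 2 = t ^ (critExp n - 2) := by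
  have hn' : (3 : ℝ) ≤ n := by exact_mod_cast hn
  have hexp : critExp n - 2 = 2 / ((n : ℝ) - 2) * 2 := by
    have : (n : ℝ) - 2 ≠ 0 := by linarith
    rw [critExp]
    field_simp
    ring
  rw [hexp, Real.rpow_mul ht, Real.rpow_two]

theorem memLp_abs_fn_rpow (hn : 3 ≤ n) (u : H10 Ω) :
    MemLp (fun x => |fn u x| ^ (2 / ((n : ℝ) - 2))) (ENNReal.ofReal n) (vol Ω) := by
  have hn' : (3 : ℝ) ≤ n := by exact_mod_cast hn
  have hpos : 0 < 2 / ((n : ℝ) - 2) := div_pos two_pos (by linarith)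
  have hexp : critExp n / (2 / ((n : ℝ) - 2)) = n := by
    have : (n : ℝ) - 2 ≠ 0 := by linarith
    rw [critExp]
    field_simp
  have hmem := (memLp_critExp hn u).norm_rpow_div (ENNReal.ofReal (2 / ((n : ℝ) - 2)))
  rwa [ENNReal.toReal_ofReal hpos.le, ← ENNReal.ofReal_div_of_pos hpos, hexp] at hmem

/-- Multiplication by `|u|^{2/(n-2)}` from `H¹₀(Ω)` to `L²(Ω)`. The square of this factor is the
weight `|u|^{2*-2}`. -/
def critWeightMul (hn : 3 ≤ n) (u : H10 Ω) : H10 Ω →L[ℝ] Lp ℝ 2 (vol Ω) :=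
  weightMul hn (memLp_abs_fn_rpow hn u)

theorem critWeightMul_ae (hn : 3 ≤ n) (u v : H10 Ω) :
    critWeightMul hn u v =ᵐ[vol Ω] fun x => |fn u x| ^ (2 / ((n : ℝ) - 2)) * fn v x :=
  weightMul_ae hn _ v

theorem inner_critWeightMul_eq_integral (hn : 3 ≤ n) (u v v' : H10 Ω) :
    inner ℝ (critWeightMul hn u v) (critWeightMul hn u v') =
      ∫ x, |fn u x| ^ (critExp n - 2) * fn v x * fn v' x ∂vol Ω := by
  rw [critWeightMul, inner_weightMul_eq_integral]
  simp only [rpow_two_div_sq hn (abs_nonneg _)]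

theorem critWeightMul_self_ne_zero (hn : 3 ≤ n) {u : H10 Ω} (hu : u ≠ 0) :
    critWeightMul hn u u ≠ 0 := by
  refine fun h0 => hu (eq_zero_of_fn_eq_zero (Lp.eq_zero_iff_ae_eq_zero.2 ?_))
  filter_upwards [critWeightMul_ae hn u u, Lp.eq_zero_iff_ae_eq_zero.1 h0] with x hmul hx
  by_contra hux
  exact mul_ne_zero (Real.rpow_pos_of_pos (abs_pos.2 hux) _).ne' hux (hmul.symm.trans hx)

theorem not_fg_range_critWeightMul (hn : 3 ≤ n) {u : H10 Ω} (hu : u ≠ 0) :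
    ¬ (LinearMap.range (critWeightMul hn u).toLinearMap).FG := by
  refine not_fg_range_weightMul hn _ fun h0 => critWeightMul_self_ne_zero hn hu ?_
  refine Lp.eq_zero_iff_ae_eq_zero.2 ((critWeightMul_ae hn u u).trans ?_)
  filter_upwards [h0] with x hx
  exact mul_eq_zero_of_left hx _

theorem rayleigh_abs_fn (hn : 3 ≤ n) (lam : ℝ) (u v : H10 Ω) :
    rayleigh lam (fun x => |fn u x|) v =
      energyForm Ω lam v v / ‖critWeightMul hn u v‖ ^ 2 := by
  rw [rayleigh, energyForm_self_eq_integral, ← real_inner_self_eq_norm_sq,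
    inner_critWeightMul_eq_integral]
  simp only [mul_assoc, sq]

theorem coe_fn_mem_weightNull_abs_fn_iff (hn : 3 ≤ n) (u v : H10 Ω) :
    (fn v : EuclideanSpace ℝ (Fin n) →ₘ[vol Ω] ℝ) ∈ weightNull Ω (fun x => |fn u x|) ↔
      critWeightMul hn u v = 0 := by
  rw [Lp.eq_zero_iff_ae_eq_zero]
  exact Filter.eventually_congr ((critWeightMul_ae hn u v).mono fun x hx => by
    rw [hx, Pi.zero_apply])

theorem linearIndependent_mkQ_weightNull_abs_fn_iff (hn : 3 ≤ n) (u : H10 Ω) {k : ℕ}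
    (v : Fin k → H10 Ω) :
    LinearIndependent ℝ (fun i => (weightNull Ω fun x => |fn u x|).mkQ
      (fn (v i) : EuclideanSpace ℝ (Fin n) →ₘ[vol Ω] ℝ)) ↔
    LinearIndependent ℝ (critWeightMul hn u ∘ v) := by
  let toAEEqFun : H10 Ω →ₗ[ℝ] (EuclideanSpace ℝ (Fin n) →ₘ[vol Ω] ℝ) :=
    (Lp.LpSubmodule ℝ ℝ 2 (vol Ω)).subtype ∘ₗ (fnCLM Ω).toLinearMap
  have hker (x : H10 Ω) : (weightNull Ω fun x => |fn u x|).mkQ (toAEEqFun x) = 0 ↔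
      critWeightMul hn u x = 0 :=
    (Submodule.Quotient.mk_eq_zero _).trans (coe_fn_mem_weightNull_abs_fn_iff hn u x)
  have hcomb (a : Fin k → ℝ) :
      ∑ i, a i • (weightNull Ω fun x => |fn u x|).mkQ (toAEEqFun (v i)) = 0 ↔
        ∑ i, a i • critWeightMul hn u (v i) = 0 := by
    simpa only [map_sum, map_smul] using hker (∑ i, a i • v i)
  change LinearIndependent ℝ
    (fun i => (weightNull Ω fun x => |fn u x|).mkQ (toAEEqFun (v i))) ↔ _
  simp only [Fintype.linearIndependent_iff, hcomb, Function.comp_apply]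

theorem genEigenvalue_abs_fn (hn : 3 ≤ n) (lam : ℝ) (u : H10 Ω) (k : ℕ) :
    genEigenvalue Ω lam (fun x => |fn u x|) k =
      minmaxValue (energyForm Ω lam) (critWeightMul hn u) k := by
  simp only [genEigenvalue, minmaxValue, HasWeightedDim, rayleigh_abs_fn hn,
    linearIndependent_mkQ_weightNull_abs_fn_iff hn]

theorem isWeakSol_abs_fn_iff (hn : 3 ≤ n) (lam μ : ℝ) (u φ : H10 Ω) :
    IsWeakSol lam φ (fun x => μ * |fn u x| ^ (critExp n - 2) * fn φ x) ↔
      ∀ v, energyForm Ω lam φ v =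
        μ * inner ℝ (critWeightMul hn u φ) (critWeightMul hn u v) := by
  simp only [IsWeakSol, energyForm_eq_integral, inner_critWeightMul_eq_integral, mul_assoc,
    integral_const_mul]

theorem exists_genEigenvalue_abs_fn_eq (hn : 3 ≤ n)
    (hΩ : volume (Ω : Set (EuclideanSpace ℝ (Fin n))) ≠ ⊤) {lam μ : ℝ} {u : H10 Ω} (hu : u ≠ 0)
    (hsol : IsWeakSol lam u (fun x => μ * |fn u x| ^ (critExp n - 2) * fn u x)) :
    ∃ k : ℕ, 1 ≤ k ∧ genEigenvalue Ω lam (fun x => |fn u x|) k = (μ : EReal) := by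
  obtain ⟨L, hL, hnonneg⟩ :=
    exists_coFG_shiftedForm_energyForm_nonneg hn hΩ (memLp_abs_fn_rpow hn u) lam μ
  simp only [genEigenvalue_abs_fn hn]
  exact exists_minmaxValue_eq (energyForm_comm lam) (not_fg_range_critWeightMul hn hu) hL hnonneg
    (critWeightMul_self_ne_zero hn hu) ((isWeakSol_abs_fn_iff hn lam μ u u).1 hsol)

theorem solvesBN_iff_isWeakSol_inv_smul {lam c : ℝ} (hc : 0 < c) (u : H10 Ω) :
    SolvesBN lam u ↔ IsWeakSol lam (c⁻¹ • u) fun x =>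
      c ^ (critExp n - 2) * |fn (c⁻¹ • u) x| ^ (critExp n - 2) * fn (c⁻¹ • u) x := by
  refine forall_congr' fun v => ?_
  have hrhs : ∫ x, c ^ (critExp n - 2) * |fn (c⁻¹ • u) x| ^ (critExp n - 2) * fn (c⁻¹ • u) x *
        fn v x ∂vol Ω = c⁻¹ * ∫ x, |fn u x| ^ (critExp n - 2) * fn u x * fn v x ∂vol Ω := by
    rw [← integral_const_mul]
    refine integral_congr_ae ?_
    filter_upwards [Lp.coeFn_smul c⁻¹ (fn u)] with x hx
    replace hx : fn (c⁻¹ • u) x = c⁻¹ * fn u x := hx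
    rw [hx, ← Real.mul_rpow hc.le (abs_nonneg _), abs_mul, abs_of_pos (inv_pos.2 hc),
      mul_inv_cancel_left₀ hc.ne']
    ring
  rw [← energyForm_eq_integral, ← energyForm_eq_integral, hrhs, map_smul, smul_apply, smul_eq_mul]
  exact (mul_right_inj' (inv_pos.2 hc).ne').symm

end CriticalWeight

end BrezisNirenberg

end

theorem mainTheorem8_general (n : ℕ) (hn : 3 ≤ n)
    (Ω : TopologicalSpace.Opens (EuclideanSpace ℝ (Fin n)))
    (hΩ : volume (Ω : Set (EuclideanSpace ℝ (Fin n))) ≠ ⊤) (lam : ℝ)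
    (u u' : BrezisNirenberg.H10 Ω) (hu : u ≠ 0)
    (hu' : u' = (BrezisNirenberg.critNorm u)⁻¹ • u) :
    BrezisNirenberg.SolvesBN lam u ↔
      ∃ k : ℕ, 1 ≤ k ∧
        BrezisNirenberg.genEigenvalue Ω lam (fun x => |BrezisNirenberg.fn u' x|) k =
          ((BrezisNirenberg.critNorm u ^ (BrezisNirenberg.critExp n - 2) : ℝ) : EReal) ∧
        u' ∈ BrezisNirenberg.genEigenspace Ω lam (fun x => |BrezisNirenberg.fn u' x|) k := by
  have hnorm := BrezisNirenberg.critNorm_pos hn hu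
  have hu'0 : u' ≠ 0 := hu' ▸ smul_ne_zero (inv_ne_zero hnorm.ne') hu
  rw [BrezisNirenberg.solvesBN_iff_isWeakSol_inv_smul hnorm, ← hu']
  constructor
  · intro hsol
    obtain ⟨k, hk, hμ⟩ := BrezisNirenberg.exists_genEigenvalue_abs_fn_eq hn hΩ hu'0 hsol
    exact ⟨k, hk, hμ, _, hμ, hsol⟩
  · rintro ⟨k, -, hμ, μ, hμ', hsol⟩
    rw [hμ', EReal.coe_eq_coe_iff] at hμ
    rwa [hμ] at hsol

theorem mainTheorem8 (n : ℕ) (hn : 3 ≤ n)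
    (Ω : TopologicalSpace.Opens (EuclideanSpace ℝ (Fin n)))
    (hΩ : BrezisNirenberg.IsSmoothBoundedDomain Ω) (lam : ℝ) (hlam : 0 ≤ lam)
    (u u' : BrezisNirenberg.H10 Ω) (hu : u ≠ 0)
    (hu' : u' = (BrezisNirenberg.critNorm u)⁻¹ • u) :
    BrezisNirenberg.SolvesBN lam u ↔
      ∃ k : ℕ, 1 ≤ k ∧
        BrezisNirenberg.genEigenvalue Ω lam (fun x => |BrezisNirenberg.fn u' x|) k =
          ((BrezisNirenberg.critNorm u ^ (BrezisNirenberg.critExp n - 2) : ℝ) : EReal) ∧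
        u' ∈ BrezisNirenberg.genEigenspace Ω lam (fun x => |BrezisNirenberg.fn u' x|) k :=
  mainTheorem8_general n hn Ω hΩ.isBounded.measure_lt_top.ne lam u u' hu hu'
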